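/- Let $R$ be a finite reduced crystallographic root system with a fixed set $\Delta$ of simple roots, let $V_0$ be a finite-dimensional real vector space containing $R$ (not necessarily spanned by it), with coroots $\alpha^\vee\in V_0^*$, and put $V=\mathbb C\otimes_{\mathbb R}V_0$. Let $W$ be the Weyl group, and let $k:\Delta\to\mathbb R$ be a function which takes equal values on simple roots in the same $W$-orbit. The graded affine Hecke algebra $\mathbb H$ is the unital associative $\mathbb C$-algebra generated by $t_w$ $(w\in W)$ and $v\in V$ such that $w\mapsto t_w$ and $v\mapsto v$ extend to algebra homomorphisms $\mathbb C[W]\to\mathbb H$ and $S(V)\to\mathbb H$, and $t_{s_\alpha}v-s_\alpha(v)t_{s_\alpha}=k_\alpha\langle v,\alpha^\vee\rangle$ for $\alpha\in\Delta$, $v\in V$. Let $\delta$ be an automorphism of the root datum (a linear automorphism of $V_0$ permuting $R$ compatibly with the coroots) with $\delta^2=\mathrm{Id}$ and $\delta(\Delta)=\Delta$, such that the automorphism $w\mapsto\delta w\delta^{-1}$ of $W$ is inner. For instance $\delta=\mathrm{Id}$, or $\delta=\theta$ with $\theta(v)=-w_0(v)$, where $w_0$ is the longest element of $W$; both induce inner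 automorphisms of $W$. Then $\delta$ acts on $\mathbb H$ by $t_w\mapsto t_{\delta w\delta^{-1}}$, $v\mapsto\delta(v)$. By an $\mathbb H\rtimes\langle\delta\rangle$-module we mean an $\mathbb H$-module with a $\mathbb C$-linear action of $\delta$ satisfying $\delta^2=1$ and $\delta(hx)=\delta(h)\delta(x)$; every $\mathbb H$-module is such a module for $\delta=\mathrm{Id}$ acting as the identity. For $\mathbb H\rtimes\langle\delta\rangle$-modules $X,Y$, let $\delta^*$ be the endomorphism of $\operatorname{Ext}^i_{\mathbb H}(X,Y)$ (Ext in the category of $\mathbb H$-modules) obtained by twisting the module structures by the automorphism $\delta$ of $\mathbb H$ and composing with the actions of $\delta$ on $X$ and $Y$; for $i=0$ it is $\psi\mapsto\delta\circ\psi\circ\delta$. Let $X$ and $Y$ be finite-dimensional $\mathbb H\rtimes\langle\delta\rangle$-modules. Then every $\operatorname{Ext}^i_{\mathbb H}(X,Y)$ is finite-dimensional, $\operatorname{Ext}^i_{\mathbb H}(X,Y)=0$ for $i>\dim V$, and $$\mathrm{EP}^\delta_{\mathbb H}(X,Y):=\sum_i(-1)^i\operatorname{tr}\bigl(\delta^*\mid\operatorname{Ext}^i_{\mathbb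 H}(X,Y)\bigr)=\frac1{|W|}\sum_{w\in W}\operatorname{tr}_X(w\delta)\,\overline{\operatorname{tr}_Y(w\delta)}\,\det\nolimits_V(1-w\delta).$$ In particular, $\mathrm{EP}^\delta_{\mathbb H}(X,Y)$ depends only on the restrictions of $X$ and $Y$ to representations of $W\rtimes\langle\delta\rangle$. For $\delta=\mathrm{Id}$ this says that for all finite-dimensional $\mathbb H$-modules $X$ and $Y$ $$\mathrm{EP}_{\mathbb H}(X,Y):=\sum_i(-1)^i\dim\operatorname{Ext}^i_{\mathbb H}(X,Y)=\frac1{|W|}\sum_{w\in W}\operatorname{tr}_X(w)\,\overline{\operatorname{tr}_Y(w)}\,\det\nolimits_V(1-w),$$ and this number depends only on the restrictions of $X$ and $Y$ to representations of $W$. -/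

import Mathlib

open CategoryTheory CategoryTheory.Abelian
open scoped TensorProduct ModuleCat ComplexConjugate

universe u

namespace GradedHecke

noncomputable section

section RootDatum

variable {ι V N : Type u} [AddCommGroup V] [Module ℝ V] [AddCommGroup N] [Module ℝ N]
  (P : RootPairing ι ℝ V N)

/-- The complexification `V = ℂ ⊗ V₀` of the real space of the root datum. -/
abbrev Cx (V : Type u) [AddCommGroup V] [Module ℝ V] : Type u := ℂ ⊗[ℝ] V

variable {P}

/-- The complexified action on `ℂ ⊗ V₀` of an automorphism of the root datum. -/
def cxAct (g : P.Aut) : Cx V →ₗ[ℂ] Cx V := (g.weightMap : V →ₗ[ℝ] V).baseChange ℂ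

variable (P) in
/-- The complex-linear functional `v ↦ ⟨v, α_i^∨⟩` on `ℂ ⊗ V₀`. -/
def cxCoroot (i : ι) : Cx V →ₗ[ℂ] ℂ :=
  LinearMap.liftBaseChange ℂ ((Algebra.linearMap ℝ ℂ).comp (P.coroot' i))

/-- A parameter function: a real function on the simple roots which takes equal values on simple
roots in the same orbit of the Weyl group. -/
def IsParameter (b : P.Base) (k : b.support → ℝ) : Prop :=
  ∀ i j : b.support, (∃ w ∈ P.weylGroup, w • P.root i = P.root j) → k i = k j

/-- An involution of the root datum (the identity is allowed) which preserves the set of simple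
roots. -/
structure IsDiagramInvolution (b : P.Base) (δ : P.Aut) : Prop where
  mul_self : δ * δ = 1
  map_base : ∀ i ∈ b.support, δ.indexEquiv i ∈ b.support

variable (P) in
/-- The automorphism `w ↦ δ w δ⁻¹` of the Weyl group `W` induced by `δ` is an inner automorphism
of `W`. -/
def InducesInner (δ : P.Aut) : Prop :=
  ∃ u ∈ P.weylGroup, ∀ w ∈ P.weylGroup, δ * w * δ⁻¹ = u * w * u⁻¹

/-- `w` is the longest element of the Weyl group: it sends every simple root (equivalently, every
positive root) to a negative root. -/
def IsLongest (b : P.Base) (w : P.Aut) : Prop :=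
  w ∈ P.weylGroup ∧
    ∀ i ∈ b.support, -(w • P.root i) ∈ AddSubmonoid.closure (P.root '' b.support)

/-- `δ` is the automorphism `θ` arising from the longest element `w₀`: `θ(v) = -w₀(v)`. -/
def IsOpposition (b : P.Base) (δ : P.Aut) : Prop :=
  ∃ w₀ : P.Aut, IsLongest b w₀ ∧ ∀ v : V, δ • v = -(w₀ • v)

lemma coroot'_smul (g : P.Aut) (i : ι) (v : V) :
    P.coroot' (g.indexEquiv i) (g • v) = P.coroot' i v := by
  have h := RootPairing.Hom.weight_coweight_transpose_apply P P
    (P.coroot (g.indexEquiv i)) g.toHom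
  rw [RootPairing.Hom.coroot_coweightMap_apply] at h
  have h2 := LinearMap.congr_fun h v
  simpa using! h2

lemma aut_ext {g h : P.Aut} (H : ∀ v : V, g • v = h • v) : g = h := by
  have h1 : g.weightMap = h.weightMap := LinearMap.ext H
  refine RootPairing.Equiv.ext h1 ?_ ?_
  · apply LinearMap.ext
    intro y
    apply P.flip.toPerfPair.injective
    rw [← RootPairing.Hom.weight_coweight_transpose_apply,
      ← RootPairing.Hom.weight_coweight_transpose_apply, h1]
  · ext i
    apply P.root.injective
    rw [← RootPairing.Hom.root_weightMap_apply, ← RootPairing.Hom.root_weightMap_apply, h1]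

lemma conj_reflection (g : P.Aut) (i : ι) :
    g * RootPairing.Equiv.reflection P i * g⁻¹
      = RootPairing.Equiv.reflection P (g.indexEquiv i) := by
  rw [mul_inv_eq_iff_eq_mul]
  apply aut_ext
  intro v
  rw [mul_smul, mul_smul, RootPairing.Equiv.reflection_smul, RootPairing.Equiv.reflection_smul,
    RootPairing.reflection_apply, RootPairing.reflection_apply, coroot'_smul, smul_sub,
    smul_comm, RootPairing.Equiv.root_indexEquiv_eq_smul]

instance weylGroup_normal : P.weylGroup.Normal where
  conj_mem n hn g := by
    induction hn using RootPairing.weylGroup.induction with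
    | mem i => rw [conj_reflection]; exact P.reflection_mem_weylGroup _
    | one => simp [one_mem]
    | mul x y _ _ hx hy =>
      have := mul_mem hx hy
      rwa [show g * x * g⁻¹ * (g * y * g⁻¹) = g * (x * y) * g⁻¹ by group] at this

/-- The automorphism `w ↦ δ w δ⁻¹` of the Weyl group. -/
def weylConj (δ : P.Aut) : P.weylGroup →* P.weylGroup :=
  (MulAut.conjNormal δ).toMonoidHom

@[simp] lemma weylConj_coe (δ : P.Aut) (w : P.weylGroup) :
    (weylConj δ w : P.Aut) = δ * w * δ⁻¹ := rfl

lemma cxAct_mul_apply (g h : P.Aut) (v : Cx V) : cxAct (g * h) v = cxAct g (cxAct h v) := by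
  have : (g * h).weightMap = g.weightMap ∘ₗ h.weightMap := rfl
  rw [cxAct, this, LinearMap.baseChange_comp]
  rfl

lemma cxAct_one_apply (v : Cx V) : cxAct (1 : P.Aut) v = v := by
  have : (1 : P.Aut).weightMap = LinearMap.id := rfl
  rw [cxAct, this, LinearMap.baseChange_id]
  rfl

lemma cxCoroot_cxAct (g : P.Aut) (i : ι) (v : Cx V) :
    cxCoroot P (g.indexEquiv i) (cxAct g v) = cxCoroot P i v := by
  induction v using TensorProduct.induction_on with
  | zero => simp
  | add x y hx hy => rw [map_add, map_add, map_add, hx, hy]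
  | tmul z v =>
    have := coroot'_smul g i v
    simp only [cxCoroot, cxAct, LinearMap.baseChange_tmul, LinearMap.liftBaseChange_tmul,
      LinearMap.comp_apply]
    exact congrArg (fun t : ℝ => z • (Algebra.linearMap ℝ ℂ t)) this

/-- The value of the parameter function is invariant under a diagram involution which induces an
inner automorphism of the Weyl group. -/
lemma parameter_invariant [P.IsReduced] {b : P.Base} {k : b.support → ℝ}
    (hk : IsParameter b k) {δ : P.Aut} (hδ : IsDiagramInvolution b δ) (hin : InducesInner P δ)
    (i : b.support) : k ⟨δ.indexEquiv i, hδ.map_base i i.2⟩ = k i := by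
  obtain ⟨x, hx, hxw⟩ := hin
  have h1 := hxw _ (P.reflection_mem_weylGroup i)
  rw [conj_reflection, conj_reflection] at h1
  symm
  apply hk
  set p : ι := δ.indexEquiv i
  set q : ι := x.indexEquiv i
  by_cases h : p = q
  · exact ⟨x, hx, by rw [← RootPairing.Equiv.root_indexEquiv_eq_smul]; exact congrArg P.root h.symm⟩
  by_cases h' : P.root p = -P.root q
  · refine ⟨x * RootPairing.Equiv.reflection P i, mul_mem hx (P.reflection_mem_weylGroup i), ?_⟩
    rw [mul_smul, RootPairing.Equiv.reflection_smul, RootPairing.reflection_apply_self, smul_neg,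
      ← RootPairing.Equiv.root_indexEquiv_eq_smul]
    exact h'.symm
  · exfalso
    have hli := RootPairing.IsReduced.linearIndependent P h h'
    have h2 : RootPairing.Equiv.reflection P p • P.root p
        = RootPairing.Equiv.reflection P q • P.root p := by rw [h1]
    rw [RootPairing.Equiv.reflection_smul, RootPairing.Equiv.reflection_smul,
      RootPairing.reflection_apply_self, RootPairing.reflection_apply] at h2
    have h3 := LinearIndependent.pair_iff.mp hli 2 (-(P.coroot' q (P.root p))) (by
      linear_combination (norm := module) -h2)
    norm_num at h3

end RootDatum

section Hecke

variable {ι V N : Type u} [AddCommGroup V] [Module ℝ V] [AddCommGroup N] [Module ℝ N]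
  {P : RootPairing ι ℝ V N}

/-- The generators `t_w` (`w ∈ W`) and `f_v` (`v ∈ V = ℂ ⊗ V₀`) of the graded affine Hecke
algebra. -/
inductive Gen (P : RootPairing ι ℝ V N) : Type u
  | t (w : P.weylGroup) : Gen P
  | f (v : Cx V) : Gen P

/-- The simple reflection `s_i` as an element of the Weyl group. -/
abbrev simpleRefl (P : RootPairing ι ℝ V N) (i : ι) : P.weylGroup :=
  RootPairing.weylGroup.ofIdx P i

/-- The defining relations of the graded affine Hecke algebra: the `t_w` multiply as in `ℂ[W]`, the
`f_v` are linear in `v` and commute (as in `S(V)`), and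
`t_{s_α} f_v - f_{s_α(v)} t_{s_α} = k_α ⟨v, α^∨⟩` for every simple root `α`. -/
inductive Rel (b : P.Base) (k : b.support → ℝ) :
    FreeAlgebra ℂ (Gen P) → FreeAlgebra ℂ (Gen P) → Prop
  | t_one : Rel b k (FreeAlgebra.ι ℂ (Gen.t 1)) 1
  | t_mul (w w' : P.weylGroup) : Rel b k (FreeAlgebra.ι ℂ (Gen.t (w * w')))
      (FreeAlgebra.ι ℂ (Gen.t w) * FreeAlgebra.ι ℂ (Gen.t w'))
  | f_add (v v' : Cx V) : Rel b k (FreeAlgebra.ι ℂ (Gen.f (v + v')))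
      (FreeAlgebra.ι ℂ (Gen.f v) + FreeAlgebra.ι ℂ (Gen.f v'))
  | f_smul (c : ℂ) (v : Cx V) : Rel b k (FreeAlgebra.ι ℂ (Gen.f (c • v)))
      (c • FreeAlgebra.ι ℂ (Gen.f v))
  | f_comm (v v' : Cx V) : Rel b k (FreeAlgebra.ι ℂ (Gen.f v) * FreeAlgebra.ι ℂ (Gen.f v'))
      (FreeAlgebra.ι ℂ (Gen.f v') * FreeAlgebra.ι ℂ (Gen.f v))
  | cross (i : b.support) (v : Cx V) : Rel b k
      (FreeAlgebra.ι ℂ (Gen.t (simpleRefl P i)) * FreeAlgebra.ι ℂ (Gen.f v)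
        - FreeAlgebra.ι ℂ (Gen.f (cxAct (simpleRefl P i : P.Aut) v))
          * FreeAlgebra.ι ℂ (Gen.t (simpleRefl P i)))
      (algebraMap ℂ _ ((k i : ℂ) * cxCoroot P i v))

/-- The graded affine Hecke algebra `ℍ` of a root datum with simple roots `b` and parameter
function `k`. -/
def Hecke (b : P.Base) (k : b.support → ℝ) : Type u := RingQuot (Rel b k)

instance (b : P.Base) (k : b.support → ℝ) : Ring (Hecke b k) :=
  inferInstanceAs (Ring (RingQuot (Rel b k)))

instance (b : P.Base) (k : b.support → ℝ) : Algebra ℂ (Hecke b k) :=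
  inferInstanceAs (Algebra ℂ (RingQuot (Rel b k)))

namespace Hecke

variable (b : P.Base) (k : b.support → ℝ)

/-- The quotient map from the free algebra on the generators. -/
def mk : FreeAlgebra ℂ (Gen P) →ₐ[ℂ] Hecke b k := RingQuot.mkAlgHom ℂ (Rel b k)

lemma mk_rel {x y : FreeAlgebra ℂ (Gen P)} (h : Rel b k x y) : mk b k x = mk b k y :=
  RingQuot.mkAlgHom_rel ℂ h

/-- The elements `t_w` of `ℍ`. -/
def t : P.weylGroup →* Hecke b k where
  toFun w := mk b k (FreeAlgebra.ι ℂ (Gen.t w))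
  map_one' := by rw [mk_rel b k Rel.t_one, map_one]
  map_mul' w w' := by rw [mk_rel b k (Rel.t_mul w w'), map_mul]

/-- The elements `f_v` of `ℍ`. -/
def f : Cx V →ₗ[ℂ] Hecke b k where
  toFun v := mk b k (FreeAlgebra.ι ℂ (Gen.f v))
  map_add' v v' := by rw [mk_rel b k (Rel.f_add v v'), map_add]
  map_smul' c v := by rw [mk_rel b k (Rel.f_smul c v), map_smul]; rfl

lemma f_comm (v v' : Cx V) : f b k v * f b k v' = f b k v' * f b k v := by
  simpa [f] using mk_rel b k (Rel.f_comm v v')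

lemma cross (i : b.support) (v : Cx V) :
    t b k (simpleRefl P i) * f b k v
      - f b k (cxAct (simpleRefl P i : P.Aut) v) * t b k (simpleRefl P i)
      = algebraMap ℂ _ ((k i : ℂ) * cxCoroot P i v) := by
  have := mk_rel b k (Rel.cross i v)
  rwa [map_sub, map_mul, map_mul, AlgHom.commutes] at this

variable {b k}

lemma algHom_ext {A : Type*} [Semiring A] [Algebra ℂ A] {φ ψ : Hecke b k →ₐ[ℂ] A}
    (ht : ∀ w, φ (t b k w) = ψ (t b k w)) (hf : ∀ v, φ (f b k v) = ψ (f b k v)) : φ = ψ := by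
  apply RingQuot.ringQuot_ext' ℂ
  apply FreeAlgebra.hom_ext
  funext g
  cases g with
  | t w => exact ht w
  | f v => exact hf v

variable [P.IsReduced] (hk : IsParameter b k) {δ : P.Aut} (hδ : IsDiagramInvolution b δ)
  (hin : InducesInner P δ)

/-- The automorphism of `ℍ` induced by `δ`: `t_w ↦ t_{δ w δ⁻¹}` and `f_v ↦ f_{δ(v)}`. -/
def twist : Hecke b k →ₐ[ℂ] Hecke b k :=
  RingQuot.liftAlgHom ℂ ⟨FreeAlgebra.lift ℂ (fun g : Gen P => match g with
    | Gen.t w => t b k (weylConj δ w)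
    | Gen.f v => f b k (cxAct δ v)), by
    intro x y h
    cases h with
    | t_one => simp
    | t_mul w w' => simp
    | f_add v v' => simp
    | f_smul c v => simp
    | f_comm v v' => simpa using f_comm b k _ _
    | cross i v =>
      have key : weylConj δ (simpleRefl P i) = simpleRefl P (δ.indexEquiv i) :=
        Subtype.ext (conj_reflection δ i)
      have h := cross b k ⟨δ.indexEquiv i, hδ.map_base i i.2⟩ (cxAct δ v)
      rw [parameter_invariant hk hδ hin, cxCoroot_cxAct] at h
      have h2 : cxAct (simpleRefl P (δ.indexEquiv i) : P.Aut) (cxAct δ v)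
          = cxAct δ (cxAct (simpleRefl P i : P.Aut) v) := by
        rw [← cxAct_mul_apply, ← cxAct_mul_apply, ← key, weylConj_coe, inv_mul_cancel_right]
      simp only [map_sub, map_mul, FreeAlgebra.lift_ι_apply, AlgHom.commutes] at h ⊢
      rw [key, ← h2]
      exact h⟩

@[simp] lemma twist_t (w : P.weylGroup) :
    twist hk hδ hin (t b k w) = t b k (weylConj δ w) := by
  change RingQuot.liftAlgHom ℂ _ (RingQuot.mkAlgHom ℂ _ _) = _
  rw [RingQuot.liftAlgHom_mkAlgHom_apply, FreeAlgebra.lift_ι_apply]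

@[simp] lemma twist_f (v : Cx V) :
    twist hk hδ hin (f b k v) = f b k (cxAct δ v) := by
  change RingQuot.liftAlgHom ℂ _ (RingQuot.mkAlgHom ℂ _ _) = _
  rw [RingQuot.liftAlgHom_mkAlgHom_apply, FreeAlgebra.lift_ι_apply]

lemma twist_twist (h : Hecke b k) : twist hk hδ hin (twist hk hδ hin h) = h := by
  have : (twist hk hδ hin).comp (twist hk hδ hin) = AlgHom.id ℂ (Hecke b k) := by
    apply algHom_ext
    · intro w
      simp only [AlgHom.comp_apply, twist_t, AlgHom.id_apply]
      congr 1
      apply Subtype.ext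
      have h1 : δ⁻¹ = δ := inv_eq_of_mul_eq_one_left hδ.mul_self
      rw [weylConj_coe, weylConj_coe, h1,
        show δ * (δ * (w : P.Aut) * δ) * δ = (δ * δ) * w * (δ * δ) by group, hδ.mul_self]
      simp
    · intro v
      simp only [AlgHom.comp_apply, twist_f, AlgHom.id_apply]
      rw [← cxAct_mul_apply, hδ.mul_self, cxAct_one_apply]
  exact DFunLike.congr_fun this h

end Hecke

end Hecke

section Pairings

variable {ι V N : Type u} [AddCommGroup V] [Module ℝ V] [AddCommGroup N] [Module ℝ N]
  {P : RootPairing ι ℝ V N}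

/-- The restriction `Res_W X` of an `ℍ`-module to a complex representation of `W`. -/
def resW {b : P.Base} {k : b.support → ℝ} (X : ModuleCat.{u} (Hecke b k)) :
    Representation ℂ P.weylGroup X :=
  ((Algebra.lsmul ℂ ℂ X : Hecke b k →ₐ[ℂ] Module.End ℂ X) : Hecke b k →* Module.End ℂ X).comp
    (Hecke.t b k)

variable (P) in
/-- The elliptic pairing of two representations of the Weyl group,
`|W|⁻¹ ∑_w tr_U(w) conj(tr_{U'}(w)) det_V(1 - w)`. -/
def ellipticPairing {U U' : Type*} [AddCommGroup U] [Module ℂ U] [AddCommGroup U'] [Module ℂ U']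
    (ρ : Representation ℂ P.weylGroup U) (ρ' : Representation ℂ P.weylGroup U') : ℂ :=
  (Nat.card P.weylGroup : ℂ)⁻¹ * ∑ᶠ w : P.weylGroup,
    LinearMap.trace ℂ U (ρ w) * conj (LinearMap.trace ℂ U' (ρ' w)) *
      LinearMap.det (LinearMap.id - cxAct (w : P.Aut))

/-- The `δ`-twisted elliptic pairing of two representations of `W ⋊ ⟨δ⟩`,
`|W|⁻¹ ∑_w tr_U(wδ) conj(tr_{U'}(wδ)) det_V(1 - wδ)`. A representation of `W ⋊ ⟨δ⟩` is given by the
action `ρ` of `W` and the operator `D` by which `δ` acts. -/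
def twistedEllipticPairing (δ : P.Aut) {U U' : Type*} [AddCommGroup U] [Module ℂ U]
    [AddCommGroup U'] [Module ℂ U'] (ρ : Representation ℂ P.weylGroup U) (D : Module.End ℂ U)
    (ρ' : Representation ℂ P.weylGroup U') (D' : Module.End ℂ U') : ℂ :=
  (Nat.card P.weylGroup : ℂ)⁻¹ * ∑ᶠ w : P.weylGroup,
    LinearMap.trace ℂ U (ρ w * D) * conj (LinearMap.trace ℂ U' (ρ' w * D')) *
      LinearMap.det (LinearMap.id - cxAct ((w : P.Aut) * δ))

/-- The Euler-Poincaré pairing `∑_i (-1)^i dim Ext^i_ℍ(X, Y)`, with `Ext` taken in the category of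
all `ℍ`-modules. -/
def eulerPoincare {b : P.Base} {k : b.support → ℝ} (X Y : ModuleCat.{u} (Hecke b k)) : ℂ :=
  ∑ᶠ n : ℕ, (-1) ^ n * (Module.finrank ℂ (Ext X Y n) : ℂ)

section Twisted

variable [P.IsReduced] {b : P.Base} {k : b.support → ℝ} (hk : IsParameter b k) {δ : P.Aut}
  (hδ : IsDiagramInvolution b δ) (hin : InducesInner P δ)

/-- The operator `D` makes the `ℍ`-module `X` into a module over `ℍ ⋊ ⟨δ⟩`, with `δ` acting by
`D`: one has `D² = 1` and `D h = δ(h) D` for all `h ∈ ℍ`. -/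
structure IsTwistAction (X : ModuleCat.{u} (Hecke b k)) (D : Module.End ℂ X) : Prop where
  mul_self : D * D = 1
  map_smul : ∀ (h : Hecke b k) (x : X), D (h • x) = Hecke.twist hk hδ hin h • D x

/-- The functor `X ↦ X^δ` on `ℍ`-modules: on `X^δ`, `h` acts as `δ(h)` acts on `X`. -/
abbrev twistFunctor : ModuleCat.{u} (Hecke b k) ⥤ ModuleCat.{u} (Hecke b k) :=
  ModuleCat.restrictScalars (Hecke.twist hk hδ hin).toRingHom

lemma twistFunctor_map_exact (S : ShortComplex (ModuleCat.{u} (Hecke b k))) (h : S.Exact) :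
    (S.map (twistFunctor hk hδ hin)).Exact := by
  rw [ShortComplex.ShortExact.moduleCat_exact_iff_function_exact] at h ⊢
  exact h

instance : Limits.PreservesFiniteLimits (twistFunctor hk hδ hin) := by
  have := ((Functor.exact_tfae (twistFunctor hk hδ hin)).out 1 3).mp
    (twistFunctor_map_exact hk hδ hin)
  exact this.1

instance : Limits.PreservesFiniteColimits (twistFunctor hk hδ hin) := by
  have := ((Functor.exact_tfae (twistFunctor hk hδ hin)).out 1 3).mp
    (twistFunctor_map_exact hk hδ hin)
  exact this.2

variable {hk hδ hin}

/-- The action of `δ` on `X`, as a homomorphism of `ℍ`-modules `X ⟶ X^δ`. -/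
def IsTwistAction.toTwist {X : ModuleCat.{u} (Hecke b k)} {D : Module.End ℂ X}
    (h : IsTwistAction hk hδ hin X D) : X ⟶ (twistFunctor hk hδ hin).obj X :=
  ModuleCat.ofHom (Y := (twistFunctor hk hδ hin).obj X)
    { toFun := fun x => D x
      map_add' := fun x y => D.map_add x y
      map_smul' := fun a x => h.map_smul a x }

/-- The action of `δ` on `X`, as a homomorphism of `ℍ`-modules `X^δ ⟶ X`. -/
def IsTwistAction.ofTwist {X : ModuleCat.{u} (Hecke b k)} {D : Module.End ℂ X}
    (h : IsTwistAction hk hδ hin X D) : (twistFunctor hk hδ hin).obj X ⟶ X :=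
  ModuleCat.ofHom (X := (twistFunctor hk hδ hin).obj X)
    { toFun := fun x => D x
      map_add' := fun x y => D.map_add x y
      map_smul' := fun a x => (h.map_smul (Hecke.twist hk hδ hin a) x).trans
        (congrArg (fun c : Hecke b k => c • D x) (Hecke.twist_twist hk hδ hin a)) }

/-- The map `δ^*` on `Ext^n_ℍ(X, Y)` for `ℍ ⋊ ⟨δ⟩`-modules `X` and `Y`: the composition
`Ext^n(X, Y) → Ext^n(X^δ, Y^δ) → Ext^n(X, Y)`, in which the first map is given by the exact functor
`X ↦ X^δ` and the second by composition with the actions `X ⟶ X^δ` and `Y^δ ⟶ Y` of `δ`.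
For `n = 0` it is `ψ ↦ δ ∘ ψ ∘ δ`. -/
def extTwist {X Y : ModuleCat.{u} (Hecke b k)} {DX : Module.End ℂ X} {DY : Module.End ℂ Y}
    (hX : IsTwistAction hk hδ hin X DX) (hY : IsTwistAction hk hδ hin Y DY) (n : ℕ) :
    Ext X Y n →ₗ[ℂ] Ext X Y n :=
  (Ext.mk₀ hX.toTwist).precompOfLinear ℂ Y (zero_add n) ∘ₗ
    (Ext.mk₀ hY.ofTwist).postcompOfLinear ℂ ((twistFunctor hk hδ hin).obj X) (add_zero n) ∘ₗ
      (twistFunctor hk hδ hin).mapExtLinearMap ℂ X Y n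

/-- The `δ`-twisted Euler-Poincaré pairing `∑_i (-1)^i tr(δ^* : Ext^i_ℍ(X, Y) → Ext^i_ℍ(X, Y))`. -/
def twistedEulerPoincare {X Y : ModuleCat.{u} (Hecke b k)} {DX : Module.End ℂ X}
    {DY : Module.End ℂ Y} (hX : IsTwistAction hk hδ hin X DX)
    (hY : IsTwistAction hk hδ hin Y DY) : ℂ :=
  ∑ᶠ n : ℕ, (-1) ^ n * LinearMap.trace ℂ (Ext X Y n) (extTwist hX hY n)

end Twisted

/-- `Res_W X` and `Res_W X'` are isomorphic representations of `W`. -/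
def IsoOverW {b : P.Base} {k : b.support → ℝ} (X X' : ModuleCat.{u} (Hecke b k)) : Prop :=
  ∃ e : X ≃ₗ[ℂ] X', ∀ w x, e (resW X w x) = resW X' w (e x)

/-- `X` and `X'`, with `δ` acting by `D` and `D'`, restrict to isomorphic representations of
`W ⋊ ⟨δ⟩`. -/
def IsoOverWTwist {b : P.Base} {k : b.support → ℝ} (X X' : ModuleCat.{u} (Hecke b k))
    (D : Module.End ℂ X) (D' : Module.End ℂ X') : Prop :=
  ∃ e : X ≃ₗ[ℂ] X', (∀ w x, e (resW X w x) = resW X' w (e x)) ∧ ∀ x, e (D x) = D' (e x)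

end Pairings

end

end GradedHecke

/-! ### Traces: exact sequences, Hom spaces, operators of finite order. -/

namespace LinearMap

/-! The module Y has a finite injective coresolution of Koszul type on which δ acts. Its n-th term
is the coinduced module Hom_W(ℍ, Alt^n(V, Y)), and its differential alternates the expression φ(f_v
h) - f_v φ(h) over v (`koszulD`, `coindD`). Coinduced modules are injective because W is finite and
the field is ℂ (`Coind.injective`), and Frobenius reciprocity identifies Hom_ℍ(X, coind U) with
Hom_W(X, U). Hence the alternating sum of traces on Ext(X, Y) equals the one on the spaces Hom_W(X,
Alt^n(V, Y)) (`finite_and_sum_trace_of_injective_coresolution`). Each of these traces is an average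
over W of products of traces (`trace_ext_coind`), and the identity ∑ (-1)^n tr Λ^n T = det(1 - T)
assembles the exterior powers into the determinant (`sum_trace_sandwich`). The coresolution stops at
n = dim V, which gives the vanishing of higher Ext.

Two points use the structure of ℍ. First, the differential preserves W-equivariance: the cross
relation produces an error term, but this is the exterior product of a coroot with a form vanishing
on the kernel of that coroot, hence zero (`koszulD_simpleRefl_mul`). Second, the complex is exact in
positive degrees. By the PBW theorem a W-equivariant map on ℍ is the same as an arbitrary linear map
on S(V) (`eq_of_equivariant_of_polyMap`, `exists_equivariant_extension`), and over S(V) a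
Cartan-type homotopy formula expresses an invertible Euler operator through the differential
(`koszulH_koszulD_add`, `exists_koszulD_eq_of_koszulD_eq_zero`).

The part of PBW that is not formal is the construction of an action of ℍ on ℂ[W] ⊗ S(V) (`pbwRep`).
It splits f_v into a W-equivariant part and an explicit element of ℂ[W] which already satisfies the
cross relation (`crossTerm_cross`). -/

/-- The trace of `ψ ↦ a ∘ ψ ∘ b` on a space of linear maps. -/
lemma trace_compRight_comp_lcomp {K A B : Type*} [CommRing K] [AddCommGroup A] [Module K A]
    [AddCommGroup B] [Module K B] [Module.Free K A] [Module.Finite K A] [Module.Free K B]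
    [Module.Finite K B] (a : B →ₗ[K] B) (b : A →ₗ[K] A) :
    trace K (A →ₗ[K] B) (a.compRight K ∘ₗ lcomp K B b) = trace K B a * trace K A b := by
  -- Under Hom(A, B) = A* ⊗ B the operator becomes the tensor product of the transpose of b with a.
  have key : a.compRight K ∘ₗ lcomp K B b
      = (dualTensorHomEquiv K A B).conj (TensorProduct.map (Module.Dual.transpose b) a) := by
    apply (cancel_right (dualTensorHomEquiv K A B).surjective).1
    ext f x y
    simp [LinearEquiv.conj_apply, Module.Dual.transpose_apply]
  rw [key, mul_comm, ← trace_transpose' b, ← trace_tensorProduct']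
  exact trace_conj' (M := Module.Dual K A ⊗[K] B) _ (dualTensorHomEquiv K A B)

section Trace

variable {K A B C D : Type*} [Field K] [AddCommGroup A] [Module K A] [AddCommGroup B] [Module K B]
  [AddCommGroup C] [Module K C] [AddCommGroup D] [Module K D]

/-- The trace is additive on short exact sequences. -/
lemma trace_eq_add_of_exact [FiniteDimensional K A] [FiniteDimensional K B] [FiniteDimensional K C]
    {f : A →ₗ[K] B} {g : B →ₗ[K] C} (hf : Function.Injective f) (hfg : Function.Exact f g)
    (hg : Function.Surjective g) {a : A →ₗ[K] A} {b : B →ₗ[K] B} {c : C →ₗ[K] C}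
    (hab : b ∘ₗ f = f ∘ₗ a) (hbc : g ∘ₗ b = c ∘ₗ g) :
    trace K B b = trace K A a + trace K C c := by
  obtain ⟨r, hr⟩ := f.exists_leftInverse_of_injective (ker_eq_bot.mpr hf)
  obtain ⟨s, hs⟩ := g.exists_rightInverse_of_surjective (range_eq_top.mpr hg)
  have hgf : g ∘ₗ f = 0 := hfg.linearMap_comp_eq_zero
  -- The correction of r makes q and s complementary, so that f q + s g = 1. The splitting need not
  -- be compatible with b; cyclicity of the trace does the rest.
  set q : B →ₗ[K] A := r ∘ₗ (id - s ∘ₗ g) with hq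
  have hqf : q ∘ₗ f = id := by
    rw [hq, comp_assoc, sub_comp, comp_assoc, hgf, comp_zero, sub_zero, id_comp, hr]
  have hsum : f ∘ₗ q + s ∘ₗ g = id := by
    ext x
    have hx : g (x - s (g x)) = 0 := by
      rw [map_sub, ← comp_apply g s, hs, id_apply, sub_self]
    obtain ⟨y, hy⟩ := (hfg _).mp hx
    have : q x = y := by
      simp only [hq, comp_apply, sub_apply, id_apply]
      rw [← hy, ← comp_apply r f, hr, id_apply]
    simp [this, hy]
  calc trace K B b = trace K B (b ∘ₗ (f ∘ₗ q + s ∘ₗ g)) := by rw [hsum, comp_id]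
    _ = trace K B ((f ∘ₗ a) ∘ₗ q) + trace K B ((b ∘ₗ s) ∘ₗ g) := by
      rw [comp_add, map_add, ← comp_assoc q f b, hab, ← comp_assoc g s b]
    _ = trace K A (a ∘ₗ (q ∘ₗ f)) + trace K C (c ∘ₗ (g ∘ₗ s)) := by
      rw [trace_comp_comm' q (f ∘ₗ a), trace_comp_comm' g (b ∘ₗ s), ← comp_assoc a f q,
        trace_comp_comm' a (q ∘ₗ f), ← comp_assoc s b g, hbc, comp_assoc s g c]
    _ = _ := by rw [hqf, hs, comp_id, comp_id]

/-- The trace is alternating-additive on four-term exact sequences. -/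
lemma trace_add_trace_of_exact [FiniteDimensional K A] [FiniteDimensional K B]
    [FiniteDimensional K C] [FiniteDimensional K D]
    {f : A →ₗ[K] B} {g : B →ₗ[K] C} {h : C →ₗ[K] D} (hf : Function.Injective f)
    (hfg : Function.Exact f g) (hgh : Function.Exact g h) (hh : Function.Surjective h)
    {a : A →ₗ[K] A} {b : B →ₗ[K] B} {c : C →ₗ[K] C} {d : D →ₗ[K] D}
    (hab : b ∘ₗ f = f ∘ₗ a) (hbc : g ∘ₗ b = c ∘ₗ g) (hcd : h ∘ₗ c = d ∘ₗ h) :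
    trace K B b + trace K D d = trace K A a + trace K C c := by
  -- The image of g is stable under c, so the sequence can be cut there into two short exact ones.
  have hc : ∀ x ∈ range g, c x ∈ range g := by
    rintro _ ⟨y, rfl⟩
    exact ⟨b y, congr_fun (congr_arg DFunLike.coe hbc) y⟩
  have h1 := trace_eq_add_of_exact (c := c.restrict hc) hf
    (g := g.rangeRestrict) (fun x => by rw [← hfg x, Subtype.ext_iff]; rfl)
    g.surjective_rangeRestrict hab
    (by ext x; exact congr_fun (congr_arg DFunLike.coe hbc) x)
  have h2 := trace_eq_add_of_exact (a := c.restrict hc) (f := (range g).subtype)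
    Subtype.val_injective (fun x => by rw [hgh x]; simp) hh rfl hcd
  rw [h1, h2]
  ring

/-- The trace of the restriction to the image of a projection. -/
lemma trace_restrict_eq_trace_comp_isProj [FiniteDimensional K A] {p : Submodule K A}
    {e : A →ₗ[K] A} (he : IsProj p e) {T : A →ₗ[K] A} (hT : ∀ x ∈ p, T x ∈ p) :
    trace K p (T.restrict hT) = trace K A (T ∘ₗ e) := by
  have : T ∘ₗ e = (T ∘ₗ p.subtype) ∘ₗ he.codRestrict := by ext; rfl
  rw [this, trace_comp_comm']
  congr 1
  ext x
  have := he.map_id (T x) (hT x x.2)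
  simpa using this.symm

/-- An operator of finite order over the complex numbers has a basis of eigenvectors. -/
lemma exists_eigenbasis_of_pow_eq_one {V : Type*} [AddCommGroup V] [Module ℂ V]
    [FiniteDimensional ℂ V] {T : Module.End ℂ V} {m : ℕ} (hm : m ≠ 0) (hT : T ^ m = 1) :
    ∃ (e : Module.Basis (Fin (Module.finrank ℂ V)) ℂ V) (c : Fin (Module.finrank ℂ V) → ℂ),
      (∀ i, T (e i) = c i • e i) ∧ ∀ i, c i ^ m = 1 := by
  have hss : T.IsSemisimple := by
    refine Module.End.isSemisimple_of_squarefree_aeval_eq_zero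
      (p := Polynomial.X ^ m - Polynomial.C 1) ?_ ?_
    · exact (Polynomial.separable_X_pow_sub_C 1 (by exact_mod_cast hm) one_ne_zero).squarefree
    · simp [hT]
  have hint := DirectSum.isInternal_submodule_of_iSupIndep_of_iSup_eq_top
    T.eigenspaces_iSupIndep hss.iSup_eigenspace_eq_top
  let v := hint.collectedBasis fun μ => Module.finBasis ℂ (T.eigenspace μ)
  have hv : ∀ i, T (v i) = i.1 • v i := fun i =>
    Module.End.mem_eigenspace_iff.mp (hint.collectedBasis_mem _ i)
  have := Module.Finite.finite_basis v
  have := Fintype.ofFinite ((μ : ℂ) × Fin (Module.finrank ℂ (T.eigenspace μ)))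
  let g := Fintype.equivFinOfCardEq (Module.finrank_eq_card_basis v).symm
  refine ⟨v.reindex g, fun i => (g.symm i).1, fun i => by simpa using hv (g.symm i), fun i => ?_⟩
  have hpow : ∀ n : ℕ, (T ^ n) (v (g.symm i)) = (g.symm i).1 ^ n • v (g.symm i) := by
    intro n
    induction n with
    | zero => simp
    | succ n ih => rw [pow_succ', Module.End.mul_apply, ih, map_smul, hv, smul_smul, pow_succ]
  have h := hpow m
  rw [hT, Module.End.one_apply] at h
  have h' : ((g.symm i).1 ^ m - 1) • v (g.symm i) = 0 := by rw [sub_smul, one_smul, ← h, sub_self]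
  exact sub_eq_zero.mp ((smul_eq_zero.mp h').resolve_right (v.ne_zero _))

section Diagonal

variable {V : Type*} [AddCommGroup V] [Module K V] {I : Type*} [Fintype I]

lemma toMatrix_eq_diagonal_of_apply_eq_smul [DecidableEq I] (e : Module.Basis I K V)
    {T : V →ₗ[K] V} {c : I → K} (h : ∀ i, T (e i) = c i • e i) :
    LinearMap.toMatrix e e T = Matrix.diagonal c := by
  ext i j
  rw [LinearMap.toMatrix_apply, h, map_smul, Module.Basis.repr_self, Matrix.diagonal_apply]
  by_cases hij : i = j
  · subst hij; simp
  · simp [hij]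

lemma trace_eq_sum_of_apply_eq_smul (e : Module.Basis I K V) {T : V →ₗ[K] V} {c : I → K}
    (h : ∀ i, T (e i) = c i • e i) : trace K V T = ∑ i, c i := by
  classical
  rw [trace_eq_matrix_trace K e, toMatrix_eq_diagonal_of_apply_eq_smul e h, Matrix.trace_diagonal]

lemma det_eq_prod_of_apply_eq_smul (e : Module.Basis I K V) {T : V →ₗ[K] V} {c : I → K}
    (h : ∀ i, T (e i) = c i • e i) : LinearMap.det T = ∏ i, c i := by
  classical
  rw [← LinearMap.det_toMatrix e, toMatrix_eq_diagonal_of_apply_eq_smul e h, Matrix.det_diagonal]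

/-- The wedge products of eigenvectors indexed by n-subsets form an eigenbasis of the exterior
power, so the trace is an elementary symmetric function of the eigenvalues. -/
lemma trace_exteriorPower_map_of_apply_eq_smul [LinearOrder I] (e : Module.Basis I K V)
    {T : V →ₗ[K] V} {c : I → K} (h : ∀ i, T (e i) = c i • e i) (n : ℕ) :
    trace K (⋀[K]^n V) (exteriorPower.map n T)
      = ∑ s ∈ (Finset.univ : Finset I).powersetCard n, ∏ i ∈ s, c i := by
  have := Fintype.ofFinite (Set.powersetCard I n)
  rw [trace_eq_sum_of_apply_eq_smul (e.exteriorPower n)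
    (c := fun s : Set.powersetCard I n => ∏ i ∈ s.1, c i)]
  · refine (Finset.sum_subtype _ (fun s => ?_) (fun s => ∏ i ∈ s, c i)).symm
    rw [Finset.mem_powersetCard_univ]
    rfl
  · intro s
    rw [exteriorPower.basis_apply, exteriorPower.map_apply_ιMulti_family,
      exteriorPower.ιMulti_family, exteriorPower.ιMulti_family]
    have : (⇑T ∘ ⇑e) ∘ (Set.powersetCard.ofFinEmbEquiv.symm s)
        = fun j => c (Set.powersetCard.ofFinEmbEquiv.symm s j) •
          (e ∘ (Set.powersetCard.ofFinEmbEquiv.symm s)) j := by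
      funext j
      simp [h]
    rw [this, AlternatingMap.map_smul_univ]
    congr 1
    refine (Finset.prod_map Finset.univ
      (Set.powersetCard.ofFinEmbEquiv.symm s).toEmbedding c).symm.trans ?_
    congr 1
    ext i
    refine Iff.trans ?_ (Set.powersetCard.mem_range_ofFinEmbEquiv_symm_iff_mem s i)
    simp

end Diagonal

/-- The alternating sum of the traces on the exterior powers of an operator of finite order. -/
lemma sum_trace_exteriorPower_of_pow_eq_one {V : Type*} [AddCommGroup V] [Module ℂ V]
    [FiniteDimensional ℂ V] {T : Module.End ℂ V} {m : ℕ} (hm : m ≠ 0) (hT : T ^ m = 1) :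
    ∑ n ∈ Finset.range (Module.finrank ℂ V + 1),
        (-1) ^ n * trace ℂ (⋀[ℂ]^n V) (exteriorPower.map n T)
      = LinearMap.det (LinearMap.id - T) := by
  obtain ⟨e, c, h, -⟩ := exists_eigenbasis_of_pow_eq_one hm hT
  -- The product of the 1 - c_i is expanded over subsets of the eigenbasis, grouped by cardinality.
  rw [det_eq_prod_of_apply_eq_smul e (c := fun i => 1 + -c i)
    (fun i => by simp [h, add_smul, sub_eq_add_neg]), Finset.prod_one_add,
    Finset.sum_powerset]
  simp only [trace_exteriorPower_map_of_apply_eq_smul e h, Finset.card_univ, Fintype.card_fin,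
    Finset.mul_sum]
  refine Finset.sum_congr rfl fun n _ => Finset.sum_congr rfl fun s hs => ?_
  rw [Finset.prod_neg, (Finset.mem_powersetCard.mp hs).2]

/-- For operators of finite order, the trace of the inverse is the complex conjugate. -/
lemma trace_eq_conj_trace_of_mul_eq_one {V : Type*} [AddCommGroup V] [Module ℂ V]
    [FiniteDimensional ℂ V] {T T' : Module.End ℂ V} {m : ℕ} (hm : m ≠ 0) (hT : T ^ m = 1)
    (h : T' * T = 1) : trace ℂ V T' = conj (trace ℂ V T) := by
  obtain ⟨e, c, hc, hcm⟩ := exists_eigenbasis_of_pow_eq_one hm hT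
  -- The eigenvalues are roots of unity, so their inverses are their conjugates.
  have hcn : ∀ i, conj (c i) * c i = 1 := fun i => by
    have h1 : ‖c i‖ = 1 := Complex.norm_eq_one_of_pow_eq_one (hcm i) hm
    rw [Complex.conj_mul', h1]; simp
  rw [trace_eq_sum_of_apply_eq_smul e hc,
    trace_eq_sum_of_apply_eq_smul e (c := fun i => conj (c i)), map_sum]
  intro i
  have h1 : T' (T (e i)) = e i := by rw [← Module.End.mul_apply, h, Module.End.one_apply]
  rw [hc, map_smul] at h1
  rw [← h1, smul_smul, hcn, one_smul, h1]

end Trace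

end LinearMap

/-! ### Vector-valued alternating maps and traces on them. -/

namespace AlternatingMap

variable {K V Y : Type*} [Field K] [AddCommGroup V] [Module K V] [AddCommGroup Y] [Module K Y]
  {n : ℕ}

instance [FiniteDimensional K V] [FiniteDimensional K Y] :
    FiniteDimensional K (V [⋀^Fin n]→ₗ[K] Y) :=
  Module.Finite.equiv (exteriorPower.alternatingMapLinearEquiv (R := K) (M := V) (N := Y)).symm

lemma eq_zero_of_finrank_lt [FiniteDimensional K V] (h : Module.finrank K V < n)
    (ω : V [⋀^Fin n]→ₗ[K] Y) : ω = 0 := by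
  ext v
  refine ω.map_linearDependent v fun hv => ?_
  have := hv.fintype_card_le_finrank
  rw [Fintype.card_fin] at this
  omega

/-- The operator `ω ↦ a ∘ ω ∘ b` on alternating maps. -/
def sandwich (n : ℕ) (a : Y →ₗ[K] Y) (b : V →ₗ[K] V) :
    (V [⋀^Fin n]→ₗ[K] Y) →ₗ[K] (V [⋀^Fin n]→ₗ[K] Y) where
  toFun ω := (a.compAlternatingMap ω).compLinearMap b
  map_add' ω ω' := by ext; simp
  map_smul' c ω := by ext; simp

@[simp] lemma sandwich_apply (a : Y →ₗ[K] Y) (b : V →ₗ[K] V) (ω : V [⋀^Fin n]→ₗ[K] Y)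
    (v : Fin n → V) : sandwich n a b ω v = a (ω fun i => b (v i)) := rfl

lemma sandwich_mul (a a' : Module.End K Y) (b b' : Module.End K V) :
    sandwich n a b * sandwich n a' b' = sandwich n (a * a') (b' * b) := by
  ext; simp

/-- Under Alt^n(V, Y) = Hom(Λ^n V, Y) the operator is composition with a on one side and with Λ^n b
on the other. -/
lemma trace_sandwich [FiniteDimensional K V] [FiniteDimensional K Y]
    (a : Y →ₗ[K] Y) (b : V →ₗ[K] V) :
    LinearMap.trace K _ (sandwich n a b)
      = LinearMap.trace K Y a * LinearMap.trace K _ (exteriorPower.map n b) := by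
  rw [← LinearMap.trace_compRight_comp_lcomp,
    ← LinearMap.trace_conj' _ (exteriorPower.alternatingMapLinearEquiv (R := K) (M := V) (N := Y))]
  congr 1
  ext φ v
  obtain ⟨ω, rfl⟩ := exteriorPower.alternatingMapLinearEquiv.surjective φ
  simp [LinearEquiv.conj_apply, exteriorPower.alternatingMapLinearEquiv_apply_ιMulti]
  rfl

end AlternatingMap

/-! ### Euler characteristics of Ext from finite injective coresolutions. -/

namespace CategoryTheory.Abelian.Ext

universe w v' u'

variable {K : Type*} [Field K] {C : Type u'} [Category.{v'} C] [Abelian C] [Linear K C]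
  [HasExt.{w} C]

/-- Euler characteristics of `Ext`-groups with operators from a finite injective coresolution
`0 → Z 0 → I 0 → I 1 → ⋯` with cocycle objects `Z n`. -/
theorem finite_and_sum_trace_of_injective_coresolution (X : C) (e : ℕ) :
    ∀ (Z I : ℕ → C) (f : ∀ n, Z n ⟶ I n) (g : ∀ n, I n ⟶ Z (n + 1))
      (w : ∀ n, f n ≫ g n = 0) (hS : ∀ n, (ShortComplex.mk (f n) (g n) (w n)).ShortExact)
      (_ : ∀ n, Injective (I n)) (_ : Limits.IsZero (Z e))
      (_ : ∀ n, FiniteDimensional K (Ext X (I n) 0))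
      (T : ∀ n m, Ext X (Z n) m →ₗ[K] Ext X (Z n) m)
      (TI : ∀ n, Ext X (I n) 0 →ₗ[K] Ext X (I n) 0)
      (_ : ∀ n (α : Ext X (Z n) 0), TI n (α.comp (mk₀ (f n)) (add_zero 0))
        = (T n 0 α).comp (mk₀ (f n)) (add_zero 0))
      (_ : ∀ n (α : Ext X (I n) 0), T (n + 1) 0 (α.comp (mk₀ (g n)) (add_zero 0))
        = (TI n α).comp (mk₀ (g n)) (add_zero 0))
      (_ : ∀ n m (α : Ext X (Z (n + 1)) m), T n (m + 1) (α.comp (hS n).extClass rfl)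
        = (T (n + 1) m α).comp (hS n).extClass rfl),
      (∀ m, FiniteDimensional K (Ext X (Z 0) m)) ∧ (∀ m, e ≤ m → Subsingleton (Ext X (Z 0) m)) ∧
      ∑ m ∈ Finset.range e, (-1) ^ m * LinearMap.trace K _ (T 0 m)
        = ∑ n ∈ Finset.range e, (-1) ^ n * LinearMap.trace K _ (TI n) := by
  induction e with
  | zero =>
    intro Z I f g w hS hI hZ hfd T TI hf hg hδ
    have hsub : ∀ m, Subsingleton (Ext X (Z 0) m) := fun m => by
      refine ⟨fun α β => ?_⟩
      have h0 : 𝟙 (Z 0) = 0 := hZ.eq_of_src _ _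
      rw [← comp_mk₀_id α, ← comp_mk₀_id β, h0]
      simp
    exact ⟨fun m => inferInstance, fun m _ => hsub m, by simp⟩
  | succ e ih =>
    intro Z I f g w hS hI hZ hfd T TI hf hg hδ
    -- The truncated sequence starting at Z 1 is a coresolution shorter by one step; the long exact
    -- sequence of 0 → Z 0 → I 0 → Z 1 → 0 then compares Z 0 with Z 1.
    obtain ⟨ihfd, ihsub, ihtr⟩ := ih (fun n => Z (n + 1)) (fun n => I (n + 1)) (fun n => f (n + 1))
      (fun n => g (n + 1)) (fun n => w (n + 1)) (fun n => hS (n + 1)) (fun n => hI (n + 1)) hZ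
      (fun n => hfd (n + 1)) (fun n => T (n + 1)) (fun n => TI (n + 1)) (fun n => hf (n + 1))
      (fun n => hg (n + 1)) (fun n => hδ (n + 1))
    simp only [zero_add] at ihfd ihsub ihtr
    have := hI 0
    let F : Ext X (Z 0) 0 →ₗ[K] Ext X (I 0) 0 := (mk₀ (f 0)).postcompOfLinear K X (add_zero 0)
    let G : Ext X (I 0) 0 →ₗ[K] Ext X (Z 1) 0 := (mk₀ (g 0)).postcompOfLinear K X (add_zero 0)
    let Δ : ∀ m, Ext X (Z 1) m →ₗ[K] Ext X (Z 0) (m + 1) := fun m =>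
      (hS 0).extClass.postcompOfLinear K X rfl
    have : Mono (f 0) := (hS 0).mono_f
    have hF : Function.Injective F := postcomp_mk₀_injective_of_mono X (f 0)
    have hFG : Function.Exact F G := fun α => by
      refine ⟨fun h => covariant_sequence_exact₂ X (hS 0) α h, ?_⟩
      rintro ⟨β, rfl⟩
      simp [F, G, w 0]
    have hGΔ : Function.Exact G (Δ 0) := fun α => by
      refine ⟨fun h => covariant_sequence_exact₃ X (hS 0) α rfl h, ?_⟩
      rintro ⟨β, rfl⟩
      change (β.comp (mk₀ (g 0)) (add_zero 0)).comp (hS 0).extClass rfl = 0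
      rw [comp_assoc_of_second_deg_zero, (hS 0).comp_extClass, comp_zero]
    have hΔs : ∀ m, Function.Surjective (Δ m) := fun m α =>
      covariant_sequence_exact₁ X (hS 0) α (eq_zero_of_injective _) rfl
    have hΔi : ∀ m, Function.Injective (Δ (m + 1)) := fun m => by
      rw [injective_iff_map_eq_zero]
      intro α h
      obtain ⟨β, rfl⟩ := covariant_sequence_exact₃ X (hS 0) α rfl h
      rw [eq_zero_of_injective β, zero_comp]
    have hfd0 : ∀ m, FiniteDimensional K (Ext X (Z 0) m) := by
      rintro (_ | m)
      · exact Module.Finite.of_injective F hF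
      · exact Module.Finite.of_surjective (Δ m) (hΔs m)
    refine ⟨hfd0, ?_, ?_⟩
    · rintro (_ | m) hm
      · omega
      · have := ihsub m (by omega)
        exact (hΔs m).subsingleton
    -- Since Ext^1(X, I 0) = 0, the low degrees form the sequence 0 → Hom(X, Z 0) → Hom(X, I 0) →
    -- Hom(X, Z 1) → Ext^1(X, Z 0) → 0.
    · have h4 := LinearMap.trace_add_trace_of_exact (a := T 0 0) (b := TI 0) (c := T 1 0)
        (d := T 0 1) hF hFG hGΔ (hΔs 0) (LinearMap.ext fun α => hf 0 α)
        (LinearMap.ext fun α => (hg 0 α).symm) (LinearMap.ext fun α => (hδ 0 0 α).symm)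
      -- From degree two on, the connecting map is an isomorphism compatible with the operators.
      have h5 : ∀ m, LinearMap.trace K _ (T 0 (m + 2)) = LinearMap.trace K _ (T 1 (m + 1)) := by
        intro m
        let E := LinearEquiv.ofBijective (Δ (m + 1)) ⟨hΔi m, hΔs (m + 1)⟩
        rw [← LinearMap.trace_conj' (T 1 (m + 1)) E]
        congr 1
        ext α
        obtain ⟨β, rfl⟩ := E.surjective α
        simp only [LinearEquiv.conj_apply, LinearMap.comp_apply, LinearEquiv.coe_coe,
          LinearEquiv.symm_apply_apply]
        exact hδ 0 (m + 1) β
      rw [Finset.sum_range_succ', Finset.sum_range_succ' _ e]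
      simp only [pow_succ, mul_neg_one, neg_mul, Finset.sum_neg_distrib, pow_zero, one_mul]
      rw [← ihtr]
      -- For e = 0 the sum for Z 1 is empty and contains no degree-zero term to match with the
      -- four-term sequence; there both Hom(X, Z 1) and Ext^1(X, Z 0) vanish.
      cases e with
      | zero =>
        have := ihsub 0 le_rfl
        have : Subsingleton (Ext X (Z 0) 1) := (hΔs 0).subsingleton
        have h1 : T 1 0 = 0 := LinearMap.ext fun α => Subsingleton.elim _ _
        have h2 : T 0 1 = 0 := LinearMap.ext fun α => Subsingleton.elim _ _
        rw [h1, h2] at h4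
        simp at h4 ⊢
        exact h4.symm
      | succ e =>
        rw [Finset.sum_range_succ', Finset.sum_range_succ' _ e]
        simp only [h5, pow_zero, one_mul]
        linear_combination -h4

-- Only associativity of the product is involved. With e and e' the classes of two short exact
-- sequences, h is the naturality of the class under a morphism between them.
omit [Linear K C] in
lemma comp_comp_comp_eq_of_comm {X X' Y Y' Z Z' : C} {n : ℕ} (t : Ext X X' 0) (a : Ext X' Y n)
    {e : Ext Y Z 1} {e' : Ext Y' Z' 1} {p : Ext Z Z' 0} {q : Ext Y Y' 0}
    (h : e.comp p (add_zero 1) = q.comp e' (zero_add 1)) :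
    t.comp ((a.comp e rfl).comp p (add_zero (n + 1))) (zero_add (n + 1))
      = (t.comp (a.comp q (add_zero n)) (zero_add n)).comp e' rfl := by
  rw [comp_assoc_of_third_deg_zero, h,
    comp_assoc t _ e' (zero_add n) rfl (by omega), comp_assoc_of_second_deg_zero]

/-- Postcomposition with an isomorphism. -/
noncomputable def postcompIso (K : Type*) [Field K] [Linear K C] (X : C) {Y Z : C} (φ : Y ≅ Z)
    (n : ℕ) : Ext X Y n ≃ₗ[K] Ext X Z n :=
  LinearEquiv.ofLinearMap ((mk₀ φ.hom).postcompOfLinear K X (add_zero n))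
    ((mk₀ φ.inv).postcompOfLinear K X (add_zero n))
    (by ext α; simp)
    (by ext α; simp)

/-- Traces of operators on `Ext`-groups compatible with an isomorphism `Y ≅ Z`. -/
lemma trace_eq_of_iso {X Y Z : C} (φ : Y ≅ Z) {n : ℕ} {T : Ext X Y n →ₗ[K] Ext X Y n}
    {T' : Ext X Z n →ₗ[K] Ext X Z n}
    (h : ∀ α : Ext X Y n, T' (α.comp (mk₀ φ.hom) (add_zero n))
      = (T α).comp (mk₀ φ.hom) (add_zero n)) :
    LinearMap.trace K _ T = LinearMap.trace K _ T' := by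
  rw [← LinearMap.trace_conj' T (postcompIso K X φ n)]
  congr 1
  ext α
  obtain ⟨β, rfl⟩ := (postcompIso K X φ n).surjective α
  rw [LinearEquiv.conj_apply, LinearMap.comp_apply, LinearMap.comp_apply, LinearEquiv.coe_coe,
    LinearEquiv.coe_coe, LinearEquiv.symm_apply_apply]
  exact (h β).symm

end CategoryTheory.Abelian.Ext

/-! ### Naturality of the action of δ on Ext. -/

namespace GradedHecke

variable {ι V N : Type u} [AddCommGroup V] [Module ℝ V] [AddCommGroup N] [Module ℝ N]
  {P : RootPairing ι ℝ V N} [P.IsReduced] {b : P.Base} {k : b.support → ℝ} {hk : IsParameter b k}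
  {δ : P.Aut} {hδ : IsDiagramInvolution b δ} {hin : InducesInner P δ}

section ExtTwist

variable {X Y Y' : ModuleCat.{u} (Hecke b k)} {DX : Module.End ℂ X} {DY : Module.End ℂ Y}
  {DY' : Module.End ℂ Y'} (hX : IsTwistAction hk hδ hin X DX) (hY : IsTwistAction hk hδ hin Y DY)
  (hY' : IsTwistAction hk hδ hin Y' DY')

lemma extTwist_apply (n : ℕ) (α : Ext X Y n) :
    extTwist hX hY n α = (Ext.mk₀ hX.toTwist).comp
      ((α.mapExactFunctor (twistFunctor hk hδ hin)).comp (Ext.mk₀ hY.ofTwist) (add_zero n))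
      (zero_add n) := rfl

lemma IsTwistAction.map_comp_ofTwist {f : Y ⟶ Y'} (hf : ∀ y, f.hom (DY y) = DY' (f.hom y)) :
    (twistFunctor hk hδ hin).map f ≫ hY'.ofTwist = hY.ofTwist ≫ f := by
  ext y
  exact (hf y).symm

/-- `δ^*` commutes with the maps induced by homomorphisms of `ℍ ⋊ ⟨δ⟩`-modules. -/
lemma extTwist_comp_mk₀ {f : Y ⟶ Y'} (hf : ∀ y, f.hom (DY y) = DY' (f.hom y)) (n : ℕ)
    (α : Ext X Y n) :
    extTwist hX hY' n (α.comp (Ext.mk₀ f) (add_zero n))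
      = (extTwist hX hY n α).comp (Ext.mk₀ f) (add_zero n) := by
  rw [extTwist_apply, extTwist_apply, Ext.mapExactFunctor_comp, Ext.mapExactFunctor_mk₀,
    Ext.comp_assoc_of_third_deg_zero, Ext.mk₀_comp_mk₀, IsTwistAction.map_comp_ofTwist hY hY' hf,
    Ext.comp_assoc_of_third_deg_zero, Ext.comp_assoc_of_third_deg_zero, Ext.mk₀_comp_mk₀]

/-- `δ^*` commutes with the connecting maps of short exact sequences of `ℍ ⋊ ⟨δ⟩`-modules. -/
lemma extTwist_comp_extClass {S : ShortComplex (ModuleCat.{u} (Hecke b k))} (hS : S.ShortExact)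
    {D₁ : Module.End ℂ S.X₁} {D₂ : Module.End ℂ S.X₂} {D₃ : Module.End ℂ S.X₃}
    (h₁ : IsTwistAction hk hδ hin S.X₁ D₁) (h₂ : IsTwistAction hk hδ hin S.X₂ D₂)
    (h₃ : IsTwistAction hk hδ hin S.X₃ D₃) (hf : ∀ y, S.f.hom (D₁ y) = D₂ (S.f.hom y))
    (hg : ∀ y, S.g.hom (D₂ y) = D₃ (S.g.hom y)) (n : ℕ) (α : Ext X S.X₃ n) :
    extTwist hX h₁ (n + 1) (α.comp hS.extClass rfl)
      = (extTwist hX h₃ n α).comp hS.extClass rfl := by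
  -- The actions of δ on the three terms form a morphism from the twisted sequence to the sequence
  -- itself, and extension classes are natural for such morphisms.
  let φ : S.map (twistFunctor hk hδ hin) ⟶ S :=
    { τ₁ := h₁.ofTwist
      τ₂ := h₂.ofTwist
      τ₃ := h₃.ofTwist
      comm₁₂ := (IsTwistAction.map_comp_ofTwist h₁ h₂ hf).symm
      comm₂₃ := (IsTwistAction.map_comp_ofTwist h₂ h₃ hg).symm }
  have key := ShortComplex.ShortExact.extClass_naturality
    (hS.map_of_exact (twistFunctor hk hδ hin)) hS φ
  rw [extTwist_apply, extTwist_apply, Ext.mapExactFunctor_comp, Ext.mapExactFunctor_extClass]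
  exact Ext.comp_comp_comp_eq_of_comm _ _ key

end ExtTwist

end GradedHecke

/-! ### Weyl group, root signs and the cross term. -/

namespace GradedHecke

variable {ι V N : Type u} [AddCommGroup V] [Module ℝ V] [AddCommGroup N] [Module ℝ N]
  {P : RootPairing ι ℝ V N}

section WeylGroup

/-- The roots need not span V, so an element of W is controlled through its displacement of vectors,
which stays inside the root span. -/
lemma smul_sub_mem_rootSpan {w : P.Aut} (hw : w ∈ P.weylGroup) (v : V) :
    w • v - v ∈ P.rootSpan ℝ := by
  induction hw using RootPairing.weylGroup.induction generalizing v with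
  | mem i =>
    rw [RootPairing.Equiv.reflection_smul, RootPairing.reflection_apply, sub_sub_cancel_left]
    exact neg_mem (Submodule.smul_mem _ _ (Submodule.subset_span ⟨i, rfl⟩))
  | one => simp
  | mul x y _ _ hx hy =>
    have := add_mem (hx (y • v)) (hy v)
    rwa [sub_add_sub_cancel, ← mul_smul] at this

/-- The Weyl group of a finite root system is finite. -/
lemma finite_weylGroup [Finite ι] (P : RootPairing ι ℝ V N) : Finite P.weylGroup := by
  have := Fintype.ofFinite ι
  refine Finite.of_injective (β := ι ≃ ι) (fun w => (w : P.Aut).indexEquiv) fun g h hgh => ?_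
  replace hgh : (g : P.Aut).indexEquiv = (h : P.Aut).indexEquiv := hgh
  refine Subtype.ext (aut_ext fun v => ?_)
  -- If g and h permute the roots in the same way, then gv - hv lies in the root span and pairs to
  -- zero with every coroot; the root form meets the root span trivially in its kernel.
  rw [← sub_eq_zero]
  refine Submodule.disjoint_def.mp P.disjoint_rootSpan_ker_rootForm _ ?_ ?_
  · rw [← sub_sub_sub_cancel_right _ _ v]
    exact sub_mem (smul_sub_mem_rootSpan g.2 v) (smul_sub_mem_rootSpan h.2 v)
  · rw [LinearMap.mem_ker]
    ext y
    rw [RootPairing.rootForm_apply_apply]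
    refine Finset.sum_eq_zero fun j _ => ?_
    obtain ⟨i, rfl⟩ := (g : P.Aut).indexEquiv.surjective j
    have h1 := coroot'_smul (g : P.Aut) i v
    have h2 := coroot'_smul (h : P.Aut) i v
    rw [← hgh] at h2
    rw [map_sub, h1, h2, sub_self, zero_mul]

lemma simpleRefl_mul_self (i : ι) : simpleRefl P i * simpleRefl P i = 1 := by
  refine Subtype.ext (aut_ext fun v => ?_)
  change (RootPairing.Equiv.reflection P i * RootPairing.Equiv.reflection P i) • v = (1 : P.Aut) • v
  rw [mul_smul, RootPairing.Equiv.reflection_smul, RootPairing.Equiv.reflection_smul,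
    RootPairing.reflection_same, one_smul]

lemma simpleRefl_inv (i : ι) : (simpleRefl P i)⁻¹ = simpleRefl P i :=
  inv_eq_of_mul_eq_one_left (simpleRefl_mul_self i)

lemma conj_simpleRefl (w : P.weylGroup) (i : ι) :
    w * simpleRefl P i * w⁻¹ = simpleRefl P ((w : P.Aut).indexEquiv i) :=
  Subtype.ext (conj_reflection (w : P.Aut) i)

variable [Finite ι] [P.IsCrystallographic] [P.IsReduced] (b : P.Base)

/-- The Weyl group is generated by the simple reflections. -/
lemma weylGroup_induction_simpleRefl {p : P.weylGroup → Prop} (one : p 1)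
    (mul : ∀ i ∈ b.support, ∀ w, p w → p (simpleRefl P i * w)) (w : P.weylGroup) : p w := by
  -- In this form the claim is multiplicative in w, so it reduces to reflections in arbitrary roots.
  -- These are obtained from the simple ones by conjugation.
  suffices h : ∀ w : P.weylGroup, ∀ x, p x → p (w * x) by simpa using h w 1 one
  have hrefl : ∀ i, ∀ x, p x → p (simpleRefl P i * x) := by
    intro i
    refine b.induction_reflect i (p := fun i => ∀ x, p x → p (simpleRefl P i * x)) ?_ mul ?_
    · intro i h x hx
      have h1 := conj_simpleRefl (simpleRefl P i) i
      rw [simpleRefl_mul_self, one_mul, simpleRefl_inv] at h1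
      exact h1 ▸ h x hx
    · intro i j h hj x hx
      have h1 := conj_simpleRefl (simpleRefl P j) i
      rw [simpleRefl_inv] at h1
      have h2 := mul j hj _ (h _ (mul j hj x hx))
      rw [← mul_assoc, ← mul_assoc] at h2
      exact h1 ▸ h2
  rintro ⟨w, hw⟩
  induction hw using RootPairing.weylGroup.induction with
  | mem i => exact hrefl i
  | one => intro x hx; exact (one_mul x).symm ▸ hx
  | mul g h hg hh ihg ihh =>
    intro x hx
    exact (mul_assoc (⟨g, hg⟩ : P.weylGroup) ⟨h, hh⟩ x) ▸ ihg _ (ihh x hx)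

end WeylGroup

section Reflection

lemma cxAct_simpleRefl (i : ι) (v : Cx V) :
    cxAct (simpleRefl P i : P.Aut) v = v - cxCoroot P i v • ((1 : ℂ) ⊗ₜ[ℝ] P.root i) := by
  induction v using TensorProduct.induction_on with
  | zero => simp
  | add x y hx hy => rw [map_add, hx, hy, map_add, add_smul]; abel
  | tmul z v =>
    have h : (simpleRefl P i : P.Aut).weightMap v = v - P.coroot' i v • P.root i :=
      P.reflection_apply i v
    rw [cxAct, LinearMap.baseChange_tmul, h, TensorProduct.tmul_sub, cxCoroot,
      LinearMap.liftBaseChange_tmul, TensorProduct.smul_tmul']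
    congr 1
    rw [TensorProduct.tmul_smul, TensorProduct.smul_tmul']
    congr 1
    simp [mul_comm]

lemma cxCoroot_root_self (i : ι) : cxCoroot P i ((1 : ℂ) ⊗ₜ[ℝ] P.root i) = 2 := by
  simp [cxCoroot]

lemma cxCoroot_simpleRefl (i : ι) (v : Cx V) :
    cxCoroot P i (cxAct (simpleRefl P i : P.Aut) v) = - cxCoroot P i v := by
  rw [cxAct_simpleRefl, map_sub, map_smul, cxCoroot_root_self, smul_eq_mul]
  ring

lemma cxCoroot_neg (i : ι) (v : Cx V) :
    cxCoroot P (P.reflectionPerm i i) v = - cxCoroot P i v := by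
  have h := cxCoroot_cxAct (simpleRefl P i : P.Aut) i (cxAct (simpleRefl P i : P.Aut) v)
  rw [cxCoroot_simpleRefl, ← cxAct_mul_apply] at h
  have h2 : (simpleRefl P i : P.Aut) * (simpleRefl P i : P.Aut) = 1 :=
    congr_arg Subtype.val (simpleRefl_mul_self i)
  rw [h2, cxAct_one_apply] at h
  exact h

end Reflection

section RootParameter

variable (b : P.Base)

open Classical in
/-- The extension of a parameter function to a function on the set of all roots. -/
noncomputable def rootParameter (k : b.support → ℝ) (γ : ι) : ℝ :=
  if h : ∃ i : b.support, ∃ w ∈ P.weylGroup, w • P.root i = P.root γ then k h.choose else 0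

variable {b} {k : b.support → ℝ} (hk : IsParameter b k)
include hk

/-- The chosen simple root is immaterial: two simple roots in the orbit of γ are conjugate, and k
agrees on them. -/
lemma rootParameter_eq_of_smul {γ : ι} (i : b.support)
    (h : ∃ w ∈ P.weylGroup, w • P.root i = P.root γ) : rootParameter b k γ = k i := by
  have h' : ∃ i : b.support, ∃ w ∈ P.weylGroup, w • P.root i = P.root γ := ⟨i, h⟩
  rw [rootParameter, dif_pos h']
  obtain ⟨w, hw, hwi⟩ := h
  obtain ⟨w', hw', hwi'⟩ := h'.choose_spec
  refine hk _ _ ⟨w⁻¹ * w', mul_mem (inv_mem hw) hw', ?_⟩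
  rw [mul_smul, hwi', ← hwi, inv_smul_smul]

lemma rootParameter_support (i : b.support) : rootParameter b k i = k i :=
  rootParameter_eq_of_smul hk i ⟨1, one_mem _, one_smul _ _⟩

/-- W preserves both the orbits that contain a simple root and those that do not, so the default
value 0 is harmless and no root has to be shown conjugate to a simple one. -/
lemma rootParameter_indexEquiv (w : P.weylGroup) (γ : ι) :
    rootParameter b k ((w : P.Aut).indexEquiv γ) = rootParameter b k γ := by
  by_cases h : ∃ i : b.support, ∃ w ∈ P.weylGroup, w • P.root i = P.root γ
  · obtain ⟨i, g, hg, hi⟩ := h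
    rw [rootParameter_eq_of_smul hk i ⟨g, hg, hi⟩]
    refine rootParameter_eq_of_smul hk i ⟨w * g, mul_mem w.2 hg, ?_⟩
    rw [mul_smul, hi, RootPairing.Equiv.root_indexEquiv_eq_smul]
  · have h' : ¬ ∃ i : b.support, ∃ g ∈ P.weylGroup,
        g • P.root i = P.root ((w : P.Aut).indexEquiv γ) := by
      rintro ⟨i, g, hg, hi⟩
      refine h ⟨i, (w : P.Aut)⁻¹ * g, mul_mem (inv_mem w.2) hg, ?_⟩
      rw [mul_smul, hi, RootPairing.Equiv.root_indexEquiv_eq_smul, inv_smul_smul]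
    rw [rootParameter, rootParameter, dif_neg h, dif_neg h']

end RootParameter

section Sign

variable (b : P.Base)

open Classical in
/-- The sign of a root. -/
noncomputable def rootSign (γ : ι) : ℂ := if b.IsPos γ then 1 else -1

variable {b}

lemma root_reflectionPerm_self (γ : ι) : P.root (P.reflectionPerm γ γ) = - P.root γ := by
  rw [RootPairing.root_reflectionPerm, RootPairing.reflection_apply_self]

lemma reflectionPerm_self_ne (γ : ι) : P.reflectionPerm γ γ ≠ γ := by
  intro h
  have h1 := congr_arg (fun j => P.coroot' γ (P.root j)) h
  simp only [root_reflectionPerm_self, map_neg] at h1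
  simp at h1
  norm_num at h1

lemma rootSign_neg (γ : ι) : rootSign b (P.reflectionPerm γ γ) = - rootSign b γ := by
  have h := RootPairing.Base.IsPos.neg_iff_not b γ
  change b.IsPos (P.reflectionPerm γ γ) ↔ ¬ b.IsPos γ at h
  by_cases h' : b.IsPos γ <;> simp [rootSign, h, h']

lemma rootSign_of_mem_support {i : ι} (hi : i ∈ b.support) : rootSign b i = 1 :=
  if_pos (RootPairing.Base.isPos_of_mem_support hi)

/-- A simple reflection permutes the positive roots other than its own root; for negative γ this is
applied to -γ. -/
lemma rootSign_reflectionPerm [Finite ι] [P.IsCrystallographic] [P.IsReduced] {i γ : ι} (hi : i ∈ b.support) (h : γ ≠ i)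
    (h' : γ ≠ P.reflectionPerm i i) : rootSign b (P.reflectionPerm i γ) = rootSign b γ := by
  by_cases hγ : b.IsPos γ
  · rw [rootSign, rootSign, if_pos (hγ.reflectionPerm hi h), if_pos hγ]
  · have hneg : ∀ j, b.IsPos (P.reflectionPerm j j) ↔ ¬ b.IsPos j := fun j =>
      RootPairing.Base.IsPos.neg_iff_not b j
    have h1 : P.reflectionPerm γ γ ≠ i := by
      intro h1
      apply h'
      apply P.root.injective
      rw [root_reflectionPerm_self, ← h1, root_reflectionPerm_self, neg_neg]
    have h2 := ((hneg γ).mpr hγ).reflectionPerm hi h1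
    have h3 : P.reflectionPerm i (P.reflectionPerm γ γ)
        = P.reflectionPerm (P.reflectionPerm i γ) (P.reflectionPerm i γ) := by
      apply P.root.injective
      rw [root_reflectionPerm_self, RootPairing.root_reflectionPerm, root_reflectionPerm_self,
        map_neg, RootPairing.root_reflectionPerm]
    rw [h3, hneg] at h2
    rw [rootSign, rootSign, if_neg h2, if_neg hγ]

end Sign

section CrossTerm

variable [Fintype ι] (b : P.Base) (k : b.support → ℝ) {A : Type*} [Ring A] [Algebra ℂ A]
  (τ : P.weylGroup →* A)

/-- The sum `½ ∑_{γ > 0} k_γ ⟨v, γ^∨⟩ τ(s_γ)`. -/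
noncomputable def crossTerm : Cx V →ₗ[ℂ] A :=
  ∑ γ, LinearMap.toSpanSingleton ℂ A (τ (simpleRefl P γ)) ∘ₗ
    -- The sum runs over all roots. Since the sign and the coroot both change under γ ↦ -γ, each
    -- positive root is counted twice, which turns 1/2 into 1/4.
    ((1 / 4 * rootSign b γ * rootParameter b k γ : ℂ) • cxCoroot P γ)

lemma crossTerm_apply (v : Cx V) : crossTerm b k τ v = ∑ γ,
    (1 / 4 * rootSign b γ * rootParameter b k γ * cxCoroot P γ v : ℂ) • τ (simpleRefl P γ) := by
  simp [crossTerm]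

variable {b k} [P.IsCrystallographic] [P.IsReduced] (hk : IsParameter b k)
include hk

/-- The elements `crossTerm b k τ v` satisfy the cross relations of the graded Hecke algebra. -/
lemma crossTerm_cross (i : b.support) (v : Cx V) :
    τ (simpleRefl P i) * crossTerm b k τ v
      - crossTerm b k τ (cxAct (simpleRefl P i : P.Aut) v) * τ (simpleRefl P i)
      = algebraMap ℂ A (k i * cxCoroot P i v) := by
  classical
  set s := simpleRefl P (i : ι) with hs
  have hss : τ s * τ s = 1 := by rw [← map_mul, simpleRefl_mul_self, map_one]
  -- Conjugation by s permutes the reflections in the sum and only moves the argument of the sign.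
  have h1 : τ s * crossTerm b k τ v * τ s = ∑ γ, (1 / 4 * rootSign b (P.reflectionPerm i γ) *
      rootParameter b k γ * cxCoroot P γ (cxAct (s : P.Aut) v) : ℂ) • τ (simpleRefl P γ) := by
    rw [crossTerm_apply, Finset.mul_sum, Finset.sum_mul,
      ← Equiv.sum_comp (P.reflectionPerm (i : ι))]
    refine Finset.sum_congr rfl fun γ _ => ?_
    have h2 := conj_simpleRefl s γ
    rw [hs, simpleRefl_inv, ← hs] at h2
    have h3 : P.reflectionPerm i γ = (s : P.Aut).indexEquiv γ := rfl
    have h4 : (s : P.Aut) * (s : P.Aut) = 1 := congr_arg Subtype.val (simpleRefl_mul_self (i : ι))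
    have h5 : cxCoroot P ((s : P.Aut).indexEquiv γ) v = cxCoroot P γ (cxAct (s : P.Aut) v) := by
      conv_lhs => rw [← cxAct_one_apply (P := P) v, ← h4, cxAct_mul_apply, cxCoroot_cxAct]
    have h6 : s * simpleRefl P ((s : P.Aut).indexEquiv γ) * s = simpleRefl P γ := by
      rw [← h2, mul_assoc, mul_assoc, mul_assoc, hs, simpleRefl_mul_self, mul_one, ← mul_assoc,
        simpleRefl_mul_self, one_mul]
    rw [mul_smul_comm, smul_mul_assoc, ← map_mul, ← map_mul, h3, rootParameter_indexEquiv hk, h5,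
      h6]
  have h2 : τ s * crossTerm b k τ v * τ s - crossTerm b k τ (cxAct (s : P.Aut) v)
      = (k i * cxCoroot P i v : ℂ) • τ s := by
    have hneg : simpleRefl P (P.reflectionPerm i (i : ι)) = s := by
      have := conj_simpleRefl s (i : ι)
      rw [hs, simpleRefl_mul_self, one_mul, simpleRefl_inv] at this
      exact this.symm
    have hk' : rootParameter b k (P.reflectionPerm i (i : ι)) = k i := by
      rw [← rootParameter_support hk i]
      exact rootParameter_indexEquiv hk s (i : ι)
    rw [h1, crossTerm_apply, ← Finset.sum_sub_distrib]
    -- The sign changes only at the simple root and its negative. Each of these two terms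
    -- contributes half of the right-hand side.
    rw [Finset.sum_eq_add (i : ι) (P.reflectionPerm i i) (reflectionPerm_self_ne _).symm]
    · rw [hneg, hk', rootParameter_support hk i, RootPairing.reflectionPerm_self, rootSign_neg,
        rootSign_of_mem_support i.2, cxCoroot_neg, cxCoroot_simpleRefl, ← hs, ← sub_smul,
        ← sub_smul, ← add_smul]
      congr 1
      ring
    · rintro γ - ⟨hγ, hγ'⟩
      rw [rootSign_reflectionPerm i.2 hγ hγ', sub_self]
    · simp
    · simp
  calc _ = (τ s * crossTerm b k τ v * τ s - crossTerm b k τ (cxAct (s : P.Aut) v)) * τ s := by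
        rw [sub_mul, mul_assoc (τ s * _), hss, mul_one]
    _ = _ := by rw [h2, smul_mul_assoc, hss, Algebra.algebraMap_eq_smul_one]

end CrossTerm

end GradedHecke

/-! ### The PBW theorem for the graded Hecke algebra. -/

namespace GradedHecke

noncomputable section

variable {ι V N : Type u} [AddCommGroup V] [Module ℝ V] [AddCommGroup N] [Module ℝ N]
  {P : RootPairing ι ℝ V N} {b : P.Base} {k : b.support → ℝ}

namespace Hecke

@[elab_as_elim]
lemma induction {p : Hecke b k → Prop} (h : Hecke b k) (ht : ∀ w, p (t b k w))
    (hf : ∀ v, p (f b k v)) (hc : ∀ c, p (algebraMap ℂ _ c)) (hadd : ∀ x y, p x → p y → p (x + y))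
    (hmul : ∀ x y, p x → p y → p (x * y)) : p h := by
  obtain ⟨x, rfl⟩ : ∃ x, mk b k x = h := RingQuot.mkAlgHom_surjective ℂ (Rel b k) h
  induction x using FreeAlgebra.induction with
  | grade0 c => rw [AlgHom.commutes]; exact hc c
  | grade1 g =>
    cases g with
    | t w => exact ht w
    | f v => exact hf v
  | mul x y hx hy => rw [map_mul]; exact hmul _ _ hx hy
  | add x y hx hy => rw [map_add]; exact hadd _ _ hx hy

section Lift

variable {A : Type*} [Ring A] [Algebra ℂ A] (τ : P.weylGroup →* A) (φ : Cx V →ₗ[ℂ] A)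
  (hφ : ∀ v v', φ v * φ v' = φ v' * φ v)
  (hτφ : ∀ (i : b.support) (v : Cx V),
    τ (simpleRefl P i) * φ v - φ (cxAct (simpleRefl P i : P.Aut) v) * τ (simpleRefl P i)
      = algebraMap ℂ A (k i * cxCoroot P i v))

/-- The universal property of the graded Hecke algebra. -/
def lift : Hecke b k →ₐ[ℂ] A :=
  RingQuot.liftAlgHom ℂ ⟨FreeAlgebra.lift ℂ (fun g : Gen P => match g with
    | Gen.t w => τ w
    | Gen.f v => φ v), by
    intro x y h
    cases h with
    | t_one => simp
    | t_mul w w' => simp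
    | f_add v v' => simp
    | f_smul c v => simp
    | f_comm v v' => simpa using hφ v v'
    | cross i v => simpa using hτφ i v⟩

@[simp] lemma lift_t (w : P.weylGroup) : lift τ φ hφ hτφ (t b k w) = τ w := by
  change RingQuot.liftAlgHom ℂ _ (RingQuot.mkAlgHom ℂ _ _) = _
  rw [RingQuot.liftAlgHom_mkAlgHom_apply, FreeAlgebra.lift_ι_apply]

@[simp] lemma lift_f (v : Cx V) : lift τ φ hφ hτφ (f b k v) = φ v := by
  change RingQuot.liftAlgHom ℂ _ (RingQuot.mkAlgHom ℂ _ _) = _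
  rw [RingQuot.liftAlgHom_mkAlgHom_apply, FreeAlgebra.lift_ι_apply]

end Lift

end Hecke

section Commutator

variable {A : Type*} [Ring A] [Algebra ℂ A] {t : A} {φ : Cx V →ₗ[ℂ] A} {κ : ℂ} {i : ι}

/-- Multiplying the cross relation by t on both sides and using t² = 1 gives the rule for moving t
to the left past φ v. -/
lemma mul_reflection_of_cross (ht : t * t = 1)
    (h : ∀ v, t * φ v - φ (cxAct (simpleRefl P i : P.Aut) v) * t
      = algebraMap ℂ A (κ * cxCoroot P i v)) (v : Cx V) :
    φ v * t = t * φ (cxAct (simpleRefl P i : P.Aut) v) + algebraMap ℂ A (κ * cxCoroot P i v) := by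
  have h1 := h v
  rw [sub_eq_iff_eq_add] at h1
  have h2 : (t * φ v) * t = t * (φ v * t) := mul_assoc _ _ _
  rw [h1, add_mul, mul_assoc, ht, mul_one] at h2
  have h3 := congr_arg (t * ·) h2
  simp only [← mul_assoc, ht, one_mul, mul_add] at h3
  rw [← h3, add_comm, mul_assoc, Algebra.commutes _ t, ← mul_assoc, ht, one_mul]

/-- Operators which satisfy the cross relation have commutators which are conjugated by the
simple reflection. -/
lemma commutator_mul_reflection (ht : t * t = 1)
    (h : ∀ v, t * φ v - φ (cxAct (simpleRefl P i : P.Aut) v) * t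
      = algebraMap ℂ A (κ * cxCoroot P i v)) (v u : Cx V) :
    (φ v * φ u - φ u * φ v) * t
      = t * (φ (cxAct (simpleRefl P i : P.Aut) v) * φ (cxAct (simpleRefl P i : P.Aut) u)
        - φ (cxAct (simpleRefl P i : P.Aut) u) * φ (cxAct (simpleRefl P i : P.Aut) v)) := by
  have key : ∀ v u, φ v * φ u * t
      = t * (φ (cxAct (simpleRefl P i : P.Aut) v) * φ (cxAct (simpleRefl P i : P.Aut) u))
        + (κ * cxCoroot P i v) • φ (cxAct (simpleRefl P i : P.Aut) u)
        + (κ * cxCoroot P i u) • φ v := by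
    intro v u
    rw [mul_assoc, mul_reflection_of_cross ht h u, mul_add, ← mul_assoc,
      mul_reflection_of_cross ht h v, add_mul, mul_assoc, ← Algebra.smul_def, ← Algebra.commutes,
      ← Algebra.smul_def]
  rw [sub_mul, key, key, mul_sub]
  -- With s(v) = v - ⟨v, α^∨⟩ α the linear error terms reduce to multiples of φ α that cancel under
  -- antisymmetrization in v and u.
  simp only [cxAct_simpleRefl, map_sub, map_smul]
  module

end Commutator

section PBWModule

variable {σ : Type*} (e : Module.Basis σ ℂ (Cx V))

/-- The inclusion of a vector space with basis `e` into the polynomial ring. -/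
def linPoly {K E : Type*} [CommRing K] [AddCommGroup E] [Module K E] (e : Module.Basis σ K E) :
    E →ₗ[K] MvPolynomial σ K :=
  e.constr K MvPolynomial.X

@[simp] lemma linPoly_basis {K E : Type*} [CommRing K] [AddCommGroup E] [Module K E]
    (e : Module.Basis σ K E) (i : σ) : linPoly e (e i) = MvPolynomial.X i :=
  e.constr_basis _ _ _

variable (P σ) in
/-- The space `ℂ[W] ⊗ S(V)`. -/
abbrev PBW : Type _ := P.weylGroup →₀ MvPolynomial σ ℂ

variable (P σ) in
/-- The left translation action of `W` on `ℂ[W] ⊗ S(V)`. -/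
def pbwT : P.weylGroup →* Module.End ℂ (PBW P σ) where
  toFun w := Finsupp.lmapDomain _ ℂ (w * ·)
  map_one' := by ext; simp
  map_mul' w w' := by ext; simp [mul_assoc]

@[simp] lemma pbwT_single (w w' : P.weylGroup) (p : MvPolynomial σ ℂ) :
    pbwT P σ w (Finsupp.single w' p) = Finsupp.single (w * w') p := by
  simp [pbwT]

variable [Fintype ι]

variable (b k) in
/-- The action of the equivariant elements `f_v - crossTerm v` on the summand `1 ⊗ S(V)`. -/
def pbwTildeOne : Cx V →ₗ[ℂ] MvPolynomial σ ℂ →ₗ[ℂ] PBW P σ :=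
  LinearMap.mk₂ ℂ (fun v p => Finsupp.single 1 (linPoly e v * p)
      - crossTerm (A := Module.End ℂ (PBW P σ)) b k (pbwT P σ) v (Finsupp.single 1 p))
    (fun v v' p => by simp only [map_add, add_mul, Finsupp.single_add, LinearMap.add_apply]; abel)
    (fun c v p => by
      simp only [map_smul, smul_mul_assoc, ← Finsupp.smul_single, LinearMap.smul_apply, smul_sub])
    (fun v p p' => by simp only [mul_add, Finsupp.single_add, map_add]; abel)
    (fun c v p => by simp only [mul_smul_comm, ← Finsupp.smul_single, map_smul, smul_sub])

lemma pbwTildeOne_apply (v : Cx V) (p : MvPolynomial σ ℂ) :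
    pbwTildeOne b k e v p = Finsupp.single 1 (linPoly e v * p)
      - crossTerm (A := Module.End ℂ (PBW P σ)) b k (pbwT P σ) v (Finsupp.single 1 p) := rfl

variable (b k) in
/-- The action of the equivariant elements `f_v - crossTerm v` on `ℂ[W] ⊗ S(V)`. -/
def pbwTilde : Cx V →ₗ[ℂ] Module.End ℂ (PBW P σ) where
  toFun v := Finsupp.lsum ℂ fun w =>
    pbwT P σ w ∘ₗ pbwTildeOne b k e (cxAct ((w⁻¹ : P.weylGroup) : P.Aut) v)
  map_add' v v' := by ext; simp
  map_smul' c v := by ext; simp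

lemma pbwTilde_single (v : Cx V) (w : P.weylGroup) (p : MvPolynomial σ ℂ) :
    pbwTilde b k e v (Finsupp.single w p)
      = pbwT P σ w (pbwTildeOne b k e (cxAct ((w⁻¹ : P.weylGroup) : P.Aut) v) p) := by
  simp [pbwTilde]

/-- The operators on the summand of w are defined by transport from the summand of 1, precisely so
that this equivariance holds. -/
lemma pbwT_mul_pbwTilde (w : P.weylGroup) (v : Cx V) :
    pbwT P σ w * pbwTilde b k e v = pbwTilde b k e (cxAct (w : P.Aut) v) * pbwT P σ w := by
  refine Finsupp.lhom_ext fun w' p => ?_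
  rw [Module.End.mul_apply, Module.End.mul_apply, pbwT_single, pbwTilde_single, pbwTilde_single,
    ← cxAct_mul_apply, ← Subgroup.coe_mul, mul_inv_rev, inv_mul_cancel_right, map_mul,
    Module.End.mul_apply]

variable (b k) in
/-- The action of the elements `f_v` on `ℂ[W] ⊗ S(V)`. -/
def pbwF : Cx V →ₗ[ℂ] Module.End ℂ (PBW P σ) := pbwTilde b k e + crossTerm (A := Module.End ℂ (PBW P σ)) b k (pbwT P σ)

/-- The cross term subtracted in `pbwTildeOne` is added back here, which leaves plain multiplication
on 1 ⊗ S(V). -/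
lemma pbwF_single_one (v : Cx V) (p : MvPolynomial σ ℂ) :
    pbwF b k e v (Finsupp.single 1 p) = Finsupp.single 1 (linPoly e v * p) := by
  rw [pbwF, LinearMap.add_apply, LinearMap.add_apply, pbwTilde_single, inv_one, Subgroup.coe_one,
    cxAct_one_apply, map_one, Module.End.one_apply, pbwTildeOne_apply, sub_add_cancel]

variable [P.IsCrystallographic] [P.IsReduced] (hk : IsParameter b k)
include hk

lemma pbwF_cross (i : b.support) (v : Cx V) :
    pbwT P σ (simpleRefl P i) * pbwF b k e v
      - pbwF b k e (cxAct (simpleRefl P i : P.Aut) v) * pbwT P σ (simpleRefl P i)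
      = algebraMap ℂ _ (k i * cxCoroot P i v) := by
  rw [← crossTerm_cross (A := Module.End ℂ (PBW P σ)) (pbwT P σ) hk i v, pbwF, LinearMap.add_apply, LinearMap.add_apply, mul_add,
    add_mul, pbwT_mul_pbwTilde]
  abel

/-- Commutators vanish on 1 ⊗ S(V), where the operators are multiplications. By
`commutator_mul_reflection` this vanishing passes from the summand of w to that of s_i w. -/
lemma pbwF_comm (v u : Cx V) :
    pbwF b k e v * pbwF b k e u = pbwF b k e u * pbwF b k e v := by
  suffices h : ∀ w : P.weylGroup, ∀ v u, ∀ p : MvPolynomial σ ℂ,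
      (pbwF b k e v * pbwF b k e u - pbwF b k e u * pbwF b k e v) (Finsupp.single w p) = 0 by
    rw [← sub_eq_zero]
    exact Finsupp.lhom_ext fun w p => h w v u p
  intro w
  induction w using weylGroup_induction_simpleRefl b with
  | one =>
    intro v u p
    rw [LinearMap.sub_apply, Module.End.mul_apply, Module.End.mul_apply]
    simp only [pbwF_single_one]
    rw [mul_left_comm, sub_self]
  | mul i hi w ih =>
    intro v u p
    have hss : pbwT P σ (simpleRefl P i) * pbwT P σ (simpleRefl P i) = 1 := by
      rw [← map_mul, simpleRefl_mul_self, map_one]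
    have h := LinearMap.congr_fun (commutator_mul_reflection (A := Module.End ℂ (PBW P σ)) hss
      (fun v => pbwF_cross e hk ⟨i, hi⟩ v) v u) (Finsupp.single w p)
    rw [Module.End.mul_apply, Module.End.mul_apply, ih, map_zero, pbwT_single] at h
    exact h

/-- The action of the graded Hecke algebra on `ℂ[W] ⊗ S(V)`. -/
def pbwRep : Hecke b k →ₐ[ℂ] Module.End ℂ (PBW P σ) :=
  Hecke.lift (A := Module.End ℂ (PBW P σ)) (pbwT P σ) (pbwF b k e) (pbwF_comm e hk) (pbwF_cross e hk)

@[simp] lemma pbwRep_t (w : P.weylGroup) : pbwRep e hk (Hecke.t b k w) = pbwT P σ w :=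
  Hecke.lift_t (A := Module.End ℂ (PBW P σ)) _ _ _ _ w

@[simp] lemma pbwRep_f (v : Cx V) : pbwRep e hk (Hecke.f b k v) = pbwF b k e v :=
  Hecke.lift_f (A := Module.End ℂ (PBW P σ)) _ _ _ _ v

end PBWModule

section PolyMap

variable {σ : Type*} (e : Module.Basis σ ℂ (Cx V))

-- The elements f_v commute, so they generate a commutative subalgebra, in which polynomials can be
-- evaluated.
variable (b k) in
lemma exists_polyMap : ∃ φ : MvPolynomial σ ℂ →ₐ[ℂ] Hecke b k,
    ∀ v, φ (linPoly e v) = Hecke.f b k v := by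
  let A := Algebra.adjoin ℂ (Set.range (Hecke.f b k))
  have hcomm : ∀ x ∈ Set.range (Hecke.f b k), ∀ y ∈ Set.range (Hecke.f b k), x * y = y * x := by
    rintro _ ⟨v, rfl⟩ _ ⟨u, rfl⟩
    exact Hecke.f_comm b k v u
  let : CommRing A := { (inferInstance : Ring A) with
    mul_comm := fun x y => (Algebra.isMulCommutative_adjoin ℂ hcomm).is_comm.comm x y }
  let g : MvPolynomial σ ℂ →ₐ[ℂ] A := MvPolynomial.aeval fun i =>
    ⟨Hecke.f b k (e i), Algebra.subset_adjoin ⟨e i, rfl⟩⟩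
  refine ⟨A.val.comp g, fun v => ?_⟩
  have : (A.val.comp g).toLinearMap ∘ₗ linPoly e = Hecke.f b k := by
    refine e.ext fun i => ?_
    simp [g]
  exact LinearMap.congr_fun this v

variable (b k) in
/-- The homomorphism `S(V) → ℍ`. -/
def polyMap : MvPolynomial σ ℂ →ₐ[ℂ] Hecke b k := (exists_polyMap b k e).choose

@[simp] lemma polyMap_linPoly (v : Cx V) : polyMap b k e (linPoly e v) = Hecke.f b k v :=
  (exists_polyMap b k e).choose_spec v

@[simp] lemma polyMap_X (i : σ) : polyMap b k e (MvPolynomial.X i) = Hecke.f b k (e i) := by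
  rw [← linPoly_basis e, polyMap_linPoly]

/-- The elements `t_w p` (`w ∈ W`, `p ∈ S(V)`) span `ℍ`. -/
lemma span_t_mul_polyMap [Finite ι] [P.IsCrystallographic] [P.IsReduced] :
    Submodule.span ℂ (Set.range fun x : P.weylGroup × MvPolynomial σ ℂ =>
      Hecke.t b k x.1 * polyMap b k e x.2) = ⊤ := by
  set Q := Submodule.span ℂ (Set.range fun x : P.weylGroup × MvPolynomial σ ℂ =>
      Hecke.t b k x.1 * polyMap b k e x.2) with hQ
  have hgen : ∀ w p, Hecke.t b k w * polyMap b k e p ∈ Q := fun w p =>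
    Submodule.subset_span ⟨(w, p), rfl⟩
  have hext : ∀ h : Hecke b k, (∀ w p, h * (Hecke.t b k w * polyMap b k e p) ∈ Q) →
      ∀ q ∈ Q, h * q ∈ Q := by
    intro h hh q hq
    induction hq using Submodule.span_induction with
    | mem x hx => obtain ⟨y, rfl⟩ := hx; exact hh _ _
    | zero => simp
    | add x y _ _ hx hy => rw [mul_add]; exact add_mem hx hy
    | smul c x _ hx => rw [mul_smul_comm]; exact Submodule.smul_mem _ _ hx
  have ht : ∀ w, ∀ q ∈ Q, Hecke.t b k w * q ∈ Q := fun w => hext _ fun w' p => by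
    rw [← mul_assoc, ← map_mul]; exact hgen _ _
  -- f_v is moved past t_w one simple reflection at a time; the error terms have shorter form t_w p
  -- and stay in the span. Thus Q is a left ideal, and it contains 1.
  have hf : ∀ v, ∀ q ∈ Q, Hecke.f b k v * q ∈ Q := by
    suffices h : ∀ w : P.weylGroup, ∀ v p, Hecke.f b k v * (Hecke.t b k w * polyMap b k e p) ∈ Q from
      fun v => hext _ fun w p => h w v p
    intro w
    induction w using weylGroup_induction_simpleRefl b with
    | one =>
      intro v p
      rw [map_one, one_mul, ← polyMap_linPoly e, ← map_mul]
      simpa using hgen 1 (linPoly e v * p)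
    | mul i hi w ih =>
      intro v p
      have hss : Hecke.t b k (simpleRefl P i) * Hecke.t b k (simpleRefl P i) = 1 := by
        rw [← map_mul, simpleRefl_mul_self, map_one]
      have h1 := mul_reflection_of_cross hss (Hecke.cross b k ⟨i, hi⟩) v
      rw [map_mul, mul_assoc, ← mul_assoc, h1, add_mul, mul_assoc, ← Algebra.smul_def]
      exact add_mem (ht _ _ (ih _ _)) (Submodule.smul_mem _ _ (hgen _ _))
  have hall : ∀ h : Hecke b k, ∀ q ∈ Q, h * q ∈ Q := by
    intro h
    induction h using Hecke.induction with
    | ht w => exact ht w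
    | hf v => exact hf v
    | hc c => intro q hq; rw [← Algebra.smul_def]; exact Submodule.smul_mem _ _ hq
    | hadd x y hx hy => intro q hq; rw [add_mul]; exact add_mem (hx q hq) (hy q hq)
    | hmul x y hx hy => intro q hq; rw [mul_assoc]; exact hx _ (hy q hq)
  rw [eq_top_iff]
  intro h _
  have h1 : (1 : Hecke b k) ∈ Q := by simpa using hgen 1 1
  simpa using hall h 1 h1

section Equivariant

variable {U : Type*} [AddCommGroup U] [Module ℂ U] (ρ : Representation ℂ P.weylGroup U)

/-- A `W`-equivariant map on `ℍ` is determined by its restriction to `S(V)`. -/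
lemma eq_of_equivariant_of_polyMap [Finite ι] [P.IsCrystallographic] [P.IsReduced]
    {φ φ' : Hecke b k →ₗ[ℂ] U} (h : ∀ w x, φ (Hecke.t b k w * x) = ρ w (φ x))
    (h' : ∀ w x, φ' (Hecke.t b k w * x) = ρ w (φ' x))
    (heq : ∀ p, φ (polyMap b k e p) = φ' (polyMap b k e p)) : φ = φ' := by
  refine LinearMap.ext_on_range (span_t_mul_polyMap e) fun x => ?_
  rw [h, h', heq]

/-- Every linear map on `S(V)` extends to a `W`-equivariant map on `ℍ`. -/
lemma exists_equivariant_extension [Fintype ι] [P.IsCrystallographic] [P.IsReduced]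
    (hk : IsParameter b k) (ψ : MvPolynomial σ ℂ →ₗ[ℂ] U) :
    ∃ φ : Hecke b k →ₗ[ℂ] U, (∀ w x, φ (Hecke.t b k w * x) = ρ w (φ x)) ∧
      ∀ p, φ (polyMap b k e p) = ψ p := by
  let Φ : PBW P σ →ₗ[ℂ] U := Finsupp.lsum ℂ fun w => ρ w ∘ₗ ψ
  have hΦ : ∀ w m, Φ (pbwT P σ w m) = ρ w (Φ m) := by
    intro w m
    have : Φ ∘ₗ pbwT P σ w = ρ w ∘ₗ Φ := by
      refine Finsupp.lhom_ext fun w' p => ?_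
      simp [Φ]
    exact LinearMap.congr_fun this m
  have hpoly : ∀ p q, pbwRep e hk (polyMap b k e p) (Finsupp.single 1 q) = Finsupp.single 1 (p * q) := by
    intro p
    induction p using MvPolynomial.induction_on with
    | C a =>
      intro q
      rw [← MvPolynomial.algebraMap_eq, AlgHom.commutes, AlgHom.commutes,
        Module.algebraMap_end_apply, Finsupp.smul_single, Algebra.smul_def]
    | add p p' hp hp' =>
      intro q
      rw [map_add, map_add, LinearMap.add_apply, hp, hp', add_mul, Finsupp.single_add]
    | mul_X p i hp =>
      intro q
      rw [map_mul, map_mul, Module.End.mul_apply, polyMap_X, pbwRep_f, pbwF_single_one,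
        linPoly_basis, hp, mul_assoc]
  -- An element of ℍ is applied to 1 ⊗ 1, and the result is mapped to U by w ⊗ p ↦ ρ(w) ψ(p).
  refine ⟨Φ ∘ₗ LinearMap.applyₗ (Finsupp.single 1 1) ∘ₗ (pbwRep e hk).toLinearMap, ?_, ?_⟩
  · intro w x
    simp only [LinearMap.comp_apply, AlgHom.toLinearMap_apply, map_mul, LinearMap.applyₗ_apply_apply,
      Module.End.mul_apply]
    rw [pbwRep_t, hΦ]
  · intro p
    simp only [LinearMap.comp_apply, AlgHom.toLinearMap_apply, LinearMap.applyₗ_apply_apply, hpoly]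
    simp [Φ]

end Equivariant

end PolyMap

end

end GradedHecke

/-! ### Exterior products with a linear form, and the Koszul differential. -/

namespace AlternatingMap

variable {K V Y : Type*} [Field K] [AddCommGroup V] [Module K V] [AddCommGroup Y] [Module K Y]

lemma finsetSum_apply {α ι : Type*} (s : Finset α) (f : α → V [⋀^ι]→ₗ[K] Y) (v : ι → V) :
    (∑ i ∈ s, f i) v = ∑ i ∈ s, f i v :=
  map_sum (AddMonoidHom.mk' (fun ω : V [⋀^ι]→ₗ[K] Y => ω v) fun _ _ => rfl) f s

/-- The exterior product of a linear form with an alternating map vanishing on the kernel of the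
form is zero. -/
lemma alternatizeUncurryFin_smulRight_eq_zero [FiniteDimensional K V] {n : ℕ} (l : V →ₗ[K] K)
    (η : V [⋀^Fin n]→ₗ[K] Y) {a : V} (ha : l a ≠ 0)
    (hη : ∀ v : Fin n → V, (∀ j, l (v j) = 0) → η v = 0) :
    alternatizeUncurryFin (l.smulRight η) = 0 := by
  -- In a basis made of a and a basis of the kernel of l, distinct basis vectors contain a at most
  -- once. In each term either l is applied to a kernel vector, or η is applied only to kernel
  -- vectors.
  let e := Module.Basis.mkFinCons a (Module.finBasis K (LinearMap.ker l))
    (fun c x hx h => by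
      have := congrArg l h
      rw [LinearMap.mem_ker] at hx
      simpa [hx, ha] using this)
    (fun z => ⟨-(l z / l a), by simp [ha]⟩)
  have he : ∀ i, i ≠ 0 → l (e i) = 0 := by
    intro i hi
    obtain ⟨j, rfl⟩ := Fin.exists_succ_eq.mpr hi
    simp [e]
  refine e.ext_alternating fun v hv => ?_
  rw [alternatizeUncurryFin_apply, zero_apply]
  refine Finset.sum_eq_zero fun j _ => ?_
  by_cases h0 : v j = 0
  · rw [LinearMap.smulRight_apply, smul_apply, hη, smul_zero, smul_zero]
    intro i
    refine he _ fun h => Fin.succAbove_ne j i (hv (h.trans h0.symm))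
  · simp [he _ h0]

end AlternatingMap

noncomputable section

section Koszul

open AlternatingMap (alternatizeUncurryFin alternatizeUncurryFinLM alternatizeUncurryFin_apply
  alternatizeUncurryFin_alternatizeUncurryFinLM_comp_of_symmetric)

variable {K V B B' Y : Type*} [Field K] [AddCommGroup V] [Module K V] [AddCommGroup B] [Module K B]
  [AddCommGroup B'] [Module K B'] [AddCommGroup Y] [Module K Y]

/-- The Koszul differential on `Hom(B, Alt^n(V, Y))`, for actions of `V` on `B` and `Y`. -/
def koszulD (L : V →ₗ[K] Module.End K B) (R : V →ₗ[K] Module.End K Y) (n : ℕ) :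
    (B →ₗ[K] V [⋀^Fin n]→ₗ[K] Y) →ₗ[K] (B →ₗ[K] V [⋀^Fin (n + 1)]→ₗ[K] Y) where
  toFun φ := alternatizeUncurryFinLM ∘ₗ LinearMap.mk₂ K
    (fun x v => φ (L v x) - (R v).compAlternatingMap (φ x))
    (fun x x' v => by ext; simp; abel) (fun c x v => by ext; simp [smul_sub])
    (fun x v v' => by ext; simp; abel) (fun c x v => by ext; simp [smul_sub])
  map_add' φ ψ := by
    refine LinearMap.ext fun x => ?_
    simp only [LinearMap.comp_apply, LinearMap.add_apply, ← map_add]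
    congr 1
    ext; simp [sub_add_sub_comm]
  map_smul' c φ := by
    refine LinearMap.ext fun x => ?_
    simp only [LinearMap.comp_apply, LinearMap.smul_apply, ← map_smul, RingHom.id_apply]
    congr 1

variable (L : V →ₗ[K] Module.End K B) (R : V →ₗ[K] Module.End K Y) {n : ℕ}

lemma koszulD_eq_of_forall (φ : B →ₗ[K] V [⋀^Fin n]→ₗ[K] Y) (x : B)
    (F : V →ₗ[K] V [⋀^Fin n]→ₗ[K] Y)
    (hF : ∀ v, F v = φ (L v x) - (R v).compAlternatingMap (φ x)) :
    koszulD L R n φ x = alternatizeUncurryFin F := by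
  change alternatizeUncurryFin _ = _
  congr 1
  exact LinearMap.ext fun v => (hF v).symm

lemma koszulD_apply (φ : B →ₗ[K] V [⋀^Fin n]→ₗ[K] Y) (x : B) (v : Fin (n + 1) → V) :
    koszulD L R n φ x v = ∑ j : Fin (n + 1), (-1) ^ (j : ℕ) •
      (φ (L (v j) x) (j.removeNth v) - R (v j) (φ x (j.removeNth v))) := by
  change alternatizeUncurryFin _ v = _
  rw [alternatizeUncurryFin_apply]
  rfl

/-- The operators whose alternating sum is the Koszul differential. -/
lemma exists_koszulD_eq (φ : B →ₗ[K] V [⋀^Fin n]→ₗ[K] Y) :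
    ∃ F : B →ₗ[K] V →ₗ[K] V [⋀^Fin n]→ₗ[K] Y,
      (∀ x v, F x v = φ (L v x) - (R v).compAlternatingMap (φ x)) ∧
      koszulD L R n φ = alternatizeUncurryFinLM ∘ₗ F :=
  ⟨_, fun _ _ => rfl, rfl⟩

variable {L R}

/-- The twofold difference G is symmetric in its two arguments because the actions of V commute, and
alternation kills symmetric expressions. -/
lemma koszulD_koszulD (hL : ∀ v v' x, L v (L v' x) = L v' (L v x))
    (hR : ∀ v v' y, R v (R v' y) = R v' (R v y)) (φ : B →ₗ[K] V [⋀^Fin n]→ₗ[K] Y) :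
    koszulD L R (n + 1) (koszulD L R n φ) = 0 := by
  obtain ⟨F, hF, hd⟩ := exists_koszulD_eq L R φ
  refine LinearMap.ext fun x => ?_
  rw [hd]
  let G : V →ₗ[K] V →ₗ[K] V [⋀^Fin n]→ₗ[K] Y := LinearMap.mk₂ K
    (fun v w => F (L v x) w - (R v).compAlternatingMap (F x w))
    (fun v v' w => by ext; simp; abel) (fun c v w => by ext; simp [smul_sub])
    (fun v w w' => by ext; simp; abel) (fun c v w => by ext; simp [smul_sub])
  have hG : ∀ v w, G v w = G w v := by
    intro v w
    ext u
    simp only [G, LinearMap.mk₂_apply, hF, AlternatingMap.sub_apply,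
      LinearMap.compAlternatingMap_apply, map_sub]
    rw [hL, hR]
    abel
  rw [koszulD_eq_of_forall L R _ x (alternatizeUncurryFinLM ∘ₗ G),
    alternatizeUncurryFin_alternatizeUncurryFinLM_comp_of_symmetric hG, LinearMap.zero_apply]
  intro v
  ext u
  simp [alternatizeUncurryFin_apply, G, smul_sub]

/-- Used twice: for right translations of ℍ, which makes the differential ℍ-linear, and for
restriction from ℍ to S(V). -/
lemma koszulD_comp {L' : V →ₗ[K] Module.End K B'} (r : B' →ₗ[K] B)
    (hr : ∀ v x, r (L' v x) = L v (r x)) (φ : B →ₗ[K] V [⋀^Fin n]→ₗ[K] Y) :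
    koszulD L' R n (φ ∘ₗ r) = koszulD L R n φ ∘ₗ r := by
  ext x v
  simp [koszulD_apply, hr]

end Koszul

/-! ### Exactness of the Koszul complex over the polynomial ring. -/

section Polynomial

open MvPolynomial
open AlternatingMap (alternatizeUncurryFin alternatizeUncurryFin_apply alternatizeUncurryFin_curryLeft)

variable {K V Y σ : Type*} [Field K] [AddCommGroup V] [Module K V] [AddCommGroup Y] [Module K Y]
  [Fintype σ] (e : Module.Basis σ K V)

/-- The operator `∑ i, x_i (∂_i - R_i)`, transposed to the linear maps on the polynomial ring. -/
def eulerOperator {Z : Type*} [AddCommGroup Z] [Module K Z] (R : σ → Module.End K Z) :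
    (MvPolynomial σ K →ₗ[K] Z) →ₗ[K] (MvPolynomial σ K →ₗ[K] Z) where
  toFun φ := ∑ i, (φ ∘ₗ LinearMap.mulLeft K (X i) ∘ₗ (pderiv i).toLinearMap
    - R i ∘ₗ φ ∘ₗ (pderiv i).toLinearMap)
  map_add' φ ψ := by
    rw [← Finset.sum_add_distrib]
    refine Finset.sum_congr rfl fun i _ => ?_
    ext; simp; abel
  map_smul' c φ := by
    rw [Finset.smul_sum]
    refine Finset.sum_congr rfl fun i _ => ?_
    ext; simp [smul_sub]

section Euler

variable {Z : Type*} [AddCommGroup Z] [Module K Z] (R : σ → Module.End K Z)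

lemma eulerOperator_apply (φ : MvPolynomial σ K →ₗ[K] Z) (p : MvPolynomial σ K) :
    eulerOperator R φ p = ∑ i, (φ (X i * pderiv i p) - R i (φ (pderiv i p))) := by
  simp [eulerOperator]

/-- The operator is triangular for the degree: its diagonal part multiplies by the degree, and the
remaining terms involve only monomials of smaller degree. -/
lemma eulerOperator_monomial (φ : MvPolynomial σ K →ₗ[K] Z) (m : σ →₀ ℕ) :
    eulerOperator R φ (monomial m 1) = (m.degree : K) • φ (monomial m 1)
      - ∑ i, (m i : K) • R i (φ (monomial (m - Finsupp.single i 1) 1)) := by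
  rw [eulerOperator_apply, Finset.sum_sub_distrib]
  congr 1
  · rw [Finsupp.degree_eq_sum, Nat.cast_sum, Finset.sum_smul]
    refine Finset.sum_congr rfl fun i _ => ?_
    rw [X_mul_pderiv_monomial, map_nsmul, Nat.cast_smul_eq_nsmul]
  · refine Finset.sum_congr rfl fun i _ => ?_
    rw [pderiv_monomial, one_mul, ← mul_one ((m i : ℕ) : K), ← smul_eq_mul, ← smul_monomial, map_smul,
      map_smul, smul_eq_mul, mul_one]

omit [Fintype σ] in
lemma degree_sub_single_lt {m : σ →₀ ℕ} {i : σ} (h : m i ≠ 0) :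
    (m - Finsupp.single i 1).degree < m.degree := by
  have h1 : Finsupp.single i 1 ≤ m := by
    rw [Finsupp.single_le_iff]; omega
  have h2 := congrArg Finsupp.degree (tsub_add_cancel_of_le h1)
  rw [map_add, Finsupp.degree_single] at h2
  omega

/-- The recursive solution of `(N + c) g = f` for the operator `N = eulerOperator R`. -/
def eulerSolve (c : K) (f : (σ →₀ ℕ) → Z) (m : σ →₀ ℕ) : Z :=
  ((m.degree : K) + c)⁻¹ • (f m + ∑ i, if _h : m i ≠ 0 then
    (m i : K) • R i (eulerSolve c f (m - Finsupp.single i 1)) else 0)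
termination_by m.degree
decreasing_by exact degree_sub_single_lt _h

variable [CharZero K]

/-- In characteristic zero the diagonal entries degree + c are invertible for c > 0, so the
triangular system can be solved by recursion on the degree. -/
lemma eulerOperator_add_surjective {c : ℕ} (hc : c ≠ 0) (ψ : MvPolynomial σ K →ₗ[K] Z) :
    ∃ φ, eulerOperator R φ + (c : K) • φ = ψ := by
  refine ⟨(basisMonomials σ K).constr K (eulerSolve R c fun m => ψ (monomial m 1)), ?_⟩
  refine (basisMonomials σ K).ext fun m => ?_
  have hφ : ∀ m, (basisMonomials σ K).constr K (eulerSolve R (c : K) fun m => ψ (monomial m 1))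
      (monomial m 1) = eulerSolve R (c : K) (fun m => ψ (monomial m 1)) m := fun m => by
    rw [← congrFun (coe_basisMonomials σ K) m, Module.Basis.constr_basis]
  rw [coe_basisMonomials, LinearMap.add_apply, LinearMap.smul_apply, eulerOperator_monomial]
  simp only [hφ]
  rw [sub_add_eq_add_sub, ← add_smul, sub_eq_iff_eq_add]
  conv_lhs => rw [eulerSolve]
  rw [smul_smul, mul_inv_cancel₀ (by norm_cast; omega), one_smul]
  congr 1
  refine Finset.sum_congr rfl fun i _ => ?_
  by_cases h : m i = 0 <;> simp [h]

lemma eulerOperator_add_injective {c : ℕ} (hc : c ≠ 0) {φ : MvPolynomial σ K →ₗ[K] Z}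
    (h : eulerOperator R φ + (c : K) • φ = 0) : φ = 0 := by
  suffices H : ∀ d : ℕ, ∀ m : σ →₀ ℕ, m.degree = d → φ (monomial m 1) = 0 from
    (basisMonomials σ K).ext fun m => by simpa using H _ m rfl
  intro d
  induction d using Nat.strong_induction_on with
  | _ d ih =>
    intro m hm
    have h1 := LinearMap.congr_fun h (monomial m 1)
    rw [LinearMap.add_apply, LinearMap.smul_apply, eulerOperator_monomial, sub_add_eq_add_sub,
      ← add_smul, Finset.sum_eq_zero, sub_zero, LinearMap.zero_apply] at h1
    · exact (smul_eq_zero.mp h1).resolve_left (by norm_cast; omega)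
    · intro i _
      by_cases hi : m i = 0
      · simp [hi]
      · rw [ih _ (hm ▸ degree_sub_single_lt hi) _ rfl, map_zero, smul_zero]

end Euler

/-- The contraction `φ ↦ ∑ i, ι_{e_i} ∘ φ ∘ ∂_i`. -/
def koszulH (n : ℕ) : (MvPolynomial σ K →ₗ[K] V [⋀^Fin (n + 1)]→ₗ[K] Y) →ₗ[K]
    (MvPolynomial σ K →ₗ[K] V [⋀^Fin n]→ₗ[K] Y) where
  toFun φ := ∑ i, (LinearMap.applyₗ (e i) ∘ₗ AlternatingMap.curryLeftLinearMap) ∘ₗ φ ∘ₗ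
    (pderiv i).toLinearMap
  map_add' φ ψ := by
    rw [← Finset.sum_add_distrib]
    refine Finset.sum_congr rfl fun i _ => ?_
    ext; simp
  map_smul' c φ := by
    rw [Finset.smul_sum]
    refine Finset.sum_congr rfl fun i _ => ?_
    ext; simp

lemma koszulH_apply {n : ℕ} (φ : MvPolynomial σ K →ₗ[K] V [⋀^Fin (n + 1)]→ₗ[K] Y)
    (p : MvPolynomial σ K) (v : Fin n → V) :
    koszulH e n φ p v = ∑ i, φ (pderiv i p) (Matrix.vecCons (e i) v) := by
  simp [koszulH, AlternatingMap.finsetSum_apply]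

/-- The action of `V` on the polynomial ring by multiplication. -/
def linPolyMul : V →ₗ[K] Module.End K (MvPolynomial σ K) :=
  LinearMap.mul K (MvPolynomial σ K) ∘ₗ GradedHecke.linPoly e

omit [Fintype σ] in
@[simp] lemma linPolyMul_apply (v : V) (p : MvPolynomial σ K) :
    linPolyMul e v p = GradedHecke.linPoly e v * p := rfl

omit [Fintype σ] in
lemma pderiv_linPoly (i : σ) (v : V) : pderiv i (GradedHecke.linPoly e v) = C (e.repr v i) := by
  classical
  have : (pderiv i).toLinearMap ∘ₗ GradedHecke.linPoly e
      = Algebra.linearMap K (MvPolynomial σ K) ∘ₗ e.coord i := by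
    refine e.ext fun j => ?_
    simp [pderiv_X, Pi.single_apply, Finsupp.single_apply, algebraMap_eq, eq_comm]
  simpa using LinearMap.congr_fun this v

variable {R : V →ₗ[K] Module.End K Y}

/-- The action of an endomorphism of the coefficients on alternating maps. -/
def alternatingPostcomp (n : ℕ) (g : Module.End K Y) : Module.End K (V [⋀^Fin n]→ₗ[K] Y) where
  toFun ω := g.compAlternatingMap ω
  map_add' _ _ := by ext; simp
  map_smul' _ _ := by ext; simp

/-- This is a Cartan homotopy formula: contraction and differential combine to the Euler operator on
S(V) plus the degree n + 1 of the form. -/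
lemma koszulH_koszulD_add {n : ℕ} (φ : MvPolynomial σ K →ₗ[K] V [⋀^Fin (n + 1)]→ₗ[K] Y) :
    koszulH e (n + 1) (koszulD (linPolyMul e) R (n + 1) φ)
        + koszulD (linPolyMul e) R n (koszulH e n φ)
      = eulerOperator (fun i => alternatingPostcomp (n + 1) (R (e i))) φ
        + ((n + 1 : ℕ) : K) • φ := by
  refine LinearMap.ext fun p => AlternatingMap.ext fun v => ?_
  -- Expanding each argument in turn in the basis reproduces the form once for every argument, hence
  -- n + 1 times.
  have h1 : ((n + 1 : ℕ) : K) • φ p v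
      = ∑ j : Fin (n + 1), (-1) ^ (j : ℕ) • ∑ i, e.repr (v j) i •
        φ p (Matrix.vecCons (e i) (j.removeNth v)) := by
    rw [Nat.cast_smul_eq_nsmul, ← AlternatingMap.smul_apply, ← alternatizeUncurryFin_curryLeft,
      alternatizeUncurryFin_apply]
    refine Finset.sum_congr rfl fun j _ => ?_
    congr 1
    conv_lhs => rw [← e.sum_repr (v j)]
    rw [map_sum, AlternatingMap.finsetSum_apply]
    simp
  -- The term in which the differential uses the inserted vector e_i gives the Euler operator; the
  -- others meet the second summand of the homotopy formula.
  have h2 : ∀ i, koszulD (linPolyMul e) R (n + 1) φ (pderiv i p) (Matrix.vecCons (e i) v)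
      = φ (X i * pderiv i p) v - R (e i) (φ (pderiv i p) v)
        - ∑ j : Fin (n + 1), (-1) ^ (j : ℕ) •
          (φ (GradedHecke.linPoly e (v j) * pderiv i p) (Matrix.vecCons (e i) (j.removeNth v))
            - R (v j) (φ (pderiv i p) (Matrix.vecCons (e i) (j.removeNth v)))) := by
    intro i
    rw [koszulD_apply, Fin.sum_univ_succ, sub_eq_add_neg (_ - _), ← Finset.sum_neg_distrib]
    congr 1
    · simp [Matrix.vecCons]
    · refine Finset.sum_congr rfl fun j _ => ?_
      have hj : j.succ.removeNth (Matrix.vecCons (e i) v) = Matrix.vecCons (e i) (j.removeNth v) := by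
        funext l
        refine Fin.cases ?_ (fun l => ?_) l <;> simp [Fin.removeNth]
      simp [pow_succ, hj]
  rw [LinearMap.add_apply, LinearMap.add_apply, AlternatingMap.add_apply,
    AlternatingMap.add_apply, LinearMap.smul_apply, AlternatingMap.smul_apply, h1, koszulH_apply, koszulD_apply, eulerOperator_apply]
  simp only [h2, koszulH_apply, AlternatingMap.finsetSum_apply, AlternatingMap.sub_apply, linPolyMul_apply]
  rw [Finset.sum_sub_distrib]
  have h4 : ∀ (q : Module.End K Y) (ω : V [⋀^Fin (n + 1)]→ₗ[K] Y),
      alternatingPostcomp (n + 1) q ω v = q (ω v) := fun _ _ => rfl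
  simp only [h4]
  rw [sub_add, sub_eq_add_neg _ (_ - _)]
  congr 1
  rw [neg_sub, sub_eq_iff_eq_add, Finset.sum_comm (s := Finset.univ (α := σ)), ← Finset.sum_add_distrib]
  refine Finset.sum_congr rfl fun j _ => ?_
  rw [← Finset.smul_sum, ← smul_add, map_sum, ← Finset.sum_sub_distrib, ← Finset.sum_add_distrib]
  congr 1
  refine Finset.sum_congr rfl fun i _ => ?_
  -- By the Leibniz rule the two orders differ by the derivative of the linear polynomial of v_j,
  -- which is its i-th coordinate; these coordinates are collected in `h1`.
  rw [Derivation.leibniz, pderiv_linPoly, smul_eq_mul, smul_eq_mul, map_add,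
    AlternatingMap.add_apply, mul_comm p, ← smul_eq_C_mul, map_smul, AlternatingMap.smul_apply]
  abel

/-- The Koszul complex of `Hom(K[σ], Y)` is exact in positive degrees. -/
theorem exists_koszulD_eq_of_koszulD_eq_zero [CharZero K]
    (hR : ∀ v v' y, R v (R v' y) = R v' (R v y)) {n : ℕ}
    (φ : MvPolynomial σ K →ₗ[K] V [⋀^Fin (n + 1)]→ₗ[K] Y)
    (h : koszulD (linPolyMul e) R (n + 1) φ = 0) :
    ∃ ψ, koszulD (linPolyMul e) R n ψ = φ := by
  -- Writing φ = (hd + dh) φ₁, the equations dφ = 0 and d² = 0 give (hd + dh) dφ₁ = 0. Injectivity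
  -- one degree higher forces dφ₁ = 0, hence φ = d(h φ₁). It is not necessary to know that the
  -- inverse of the Euler operator commutes with d.
  obtain ⟨φ₁, h₁⟩ := eulerOperator_add_surjective
    (fun i => alternatingPostcomp (V := V) (n + 1) (R (e i))) n.succ_ne_zero φ
  rw [← koszulH_koszulD_add e φ₁] at h₁
  have hd := fun m (ψ : MvPolynomial σ K →ₗ[K] V [⋀^Fin m]→ₗ[K] Y) =>
    koszulD_koszulD (L := linPolyMul e) (fun v v' x => by simp [mul_left_comm]) hR ψ
  have h₂ : koszulD (linPolyMul e) R (n + 1) φ₁ = 0 := by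
    refine eulerOperator_add_injective
      (fun i => alternatingPostcomp (V := V) (n + 1 + 1) (R (e i))) (n + 1).succ_ne_zero ?_
    rw [← koszulH_koszulD_add e, hd, map_zero, zero_add]
    rw [← h, ← h₁, map_add, hd, add_zero]
  rw [h₂, map_zero, zero_add] at h₁
  exact ⟨_, h₁⟩

end Polynomial

end

/-! ### Coinduced modules, Frobenius reciprocity and traces of equivariant maps. -/

namespace Representation

variable {K G A B : Type*} [Field K] [Group G] [AddCommGroup A] [Module K A] [AddCommGroup B]
  [Module K B] {ρ : Representation K G A} {τ : Representation K G B}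

lemma mem_invariants_linHom_iff {f : A →ₗ[K] B} :
    f ∈ (linHom ρ τ).invariants ↔ ∀ g x, f (ρ g x) = τ g (f x) := by
  rw [mem_invariants]
  refine ⟨fun h g x => ?_, fun h g => LinearMap.ext fun x => ?_⟩
  · conv_lhs => rw [← h g]
    simp
  · rw [linHom_apply, LinearMap.comp_apply, LinearMap.comp_apply, ← h, self_inv_apply]

lemma averageMap_apply [Fintype G] [Invertible (Fintype.card G : K)] (x : A) :
    averageMap ρ x = ⅟(Fintype.card G : K) • ∑ g, ρ g x := by
  simp [averageMap, GroupAlgebra.average, map_sum]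

end Representation

namespace GradedHecke

noncomputable section

variable {ι V N : Type u} [AddCommGroup V] [Module ℝ V] [AddCommGroup N] [Module ℝ N]
  {P : RootPairing ι ℝ V N} {b : P.Base} {k : b.support → ℝ}
  {U : Type u} [AddCommGroup U] [Module ℂ U]

lemma resW_apply (X : ModuleCat.{u} (Hecke b k)) (w : P.weylGroup) (x : X) :
    resW X w x = Hecke.t b k w • x := rfl

section Coind

variable (b k) in
/-- The space of linear maps `φ : ℍ → U` such that `φ (t_w h) = ρ w (φ h)`. -/
def coindSubmodule (ρ : Representation ℂ P.weylGroup U) : Submodule ℂ (Hecke b k →ₗ[ℂ] U) where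
  carrier := {φ | ∀ w h, φ (Hecke.t b k w * h) = ρ w (φ h)}
  add_mem' := by intro φ ψ hφ hψ w h; simp [hφ w h, hψ w h]
  zero_mem' := by intro w h; simp
  smul_mem' := by intro c φ hφ w h; simp [hφ w h]

variable (b k) in
/-- The coinduced module of a representation of `W`. -/
def Coind (ρ : Representation ℂ P.weylGroup U) : Type u := coindSubmodule b k ρ

variable (ρ : Representation ℂ P.weylGroup U)

instance : AddCommGroup (Coind b k ρ) := inferInstanceAs (AddCommGroup (coindSubmodule b k ρ))

instance : Module (Hecke b k) (Coind b k ρ) where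
  smul a φ := ⟨φ.1 ∘ₗ LinearMap.mulRight ℂ a, fun w h => by simp [mul_assoc, φ.2 w]⟩
  one_smul φ := Subtype.ext (LinearMap.ext fun h => congrArg φ.1 (mul_one h))
  mul_smul a a' φ := Subtype.ext (LinearMap.ext fun h => congrArg φ.1 (mul_assoc h a a').symm)
  smul_zero a := Subtype.ext (LinearMap.ext fun h => rfl)
  zero_smul φ := Subtype.ext (LinearMap.ext fun h =>
    (congrArg φ.1 (mul_zero h)).trans (map_zero φ.1))
  smul_add a φ ψ := Subtype.ext (LinearMap.ext fun h => rfl)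
  add_smul a a' φ := Subtype.ext (LinearMap.ext fun h =>
    (congrArg φ.1 (mul_add h a a')).trans (map_add φ.1 _ _))

variable (b k) in
/-- The coinduced module of a representation of `W`, as an object of the category of modules. -/
def coindObj : ModuleCat.{u} (Hecke b k) := ModuleCat.of (Hecke b k) (Coind b k ρ)

variable {ρ}

namespace Coind

/-- The linear map underlying an element of the coinduced module. -/
def val (φ : coindObj b k ρ) : Hecke b k →ₗ[ℂ] U := φ.1

/-- The element of the coinduced module given by an equivariant linear map. -/
def mk (φ : Hecke b k →ₗ[ℂ] U) (h : φ ∈ coindSubmodule b k ρ) : coindObj b k ρ :=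
  (⟨φ, h⟩ : coindSubmodule b k ρ)

@[simp] lemma val_mk (φ : Hecke b k →ₗ[ℂ] U) (h : φ ∈ coindSubmodule b k ρ) : val (mk φ h) = φ :=
  rfl

lemma val_mem (φ : coindObj b k ρ) : val φ ∈ coindSubmodule b k ρ := φ.2

lemma ext {φ ψ : coindObj b k ρ} (h : ∀ x, val φ x = val ψ x) : φ = ψ :=
  Subtype.ext (LinearMap.ext h)

lemma val_t_mul (φ : coindObj b k ρ) (w : P.weylGroup) (h : Hecke b k) :
    val φ (Hecke.t b k w * h) = ρ w (val φ h) := φ.2 w h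

@[simp] lemma val_zero : val (0 : coindObj b k ρ) = 0 := rfl

@[simp] lemma val_add (φ ψ : coindObj b k ρ) : val (φ + ψ) = val φ + val ψ := rfl

@[simp] lemma val_smul_apply (a : Hecke b k) (φ : coindObj b k ρ) (h : Hecke b k) :
    val (a • φ) h = val φ (h * a) := rfl

@[simp] lemma val_complex_smul (c : ℂ) (φ : coindObj b k ρ) : val (c • φ) = c • val φ := by
  refine LinearMap.ext fun h => ?_
  rw [← algebraMap_smul (Hecke b k) c φ, val_smul_apply, ← Algebra.commutes, ← Algebra.smul_def,
    map_smul, LinearMap.smul_apply]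

/-- Frobenius reciprocity: the homomorphism into the coinduced module given by a `W`-equivariant
map. -/
def lift {X : ModuleCat.{u} (Hecke b k)} (ψ : X →ₗ[ℂ] U)
    (hψ : ψ ∈ (Representation.linHom (resW X) ρ).invariants) : X ⟶ coindObj b k ρ :=
  ModuleCat.ofHom
    { toFun := fun x => mk {
          toFun := fun h => ψ (h • x)
          map_add' := fun h h' => by rw [add_smul, map_add]
          map_smul' := fun c h => by rw [smul_assoc, map_smul, RingHom.id_apply] }
        fun w h => by
          rw [LinearMap.coe_mk, AddHom.coe_mk, mul_smul, ← resW_apply,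
            Representation.mem_invariants_linHom_iff.mp hψ]
      map_add' := fun x y => Coind.ext fun h => by
        change ψ _ = ψ _ + ψ _
        rw [smul_add, map_add]
      map_smul' := fun a x => Coind.ext fun h => by
        change ψ (h • a • x) = ψ ((h * a) • x)
        rw [smul_smul] }

/-- The `W`-equivariant map given by a homomorphism into a coinduced module. -/
def eval {X : ModuleCat.{u} (Hecke b k)} : (X ⟶ coindObj b k ρ) →ₗ[ℂ] (X →ₗ[ℂ] U) where
  toFun f :=
    { toFun := fun x => val (f.hom x) 1
      map_add' := fun x y => by rw [map_add, val_add, LinearMap.add_apply]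
      map_smul' := fun c x => by
        rw [← algebraMap_smul (Hecke b k) c x, map_smul, algebraMap_smul, val_complex_smul]
        rfl }
  map_add' f g := rfl
  map_smul' c f := LinearMap.ext fun x =>
    LinearMap.congr_fun (val_complex_smul c (f.hom x)) (1 : Hecke b k)

@[simp] lemma eval_apply {X : ModuleCat.{u} (Hecke b k)} (f : X ⟶ coindObj b k ρ) (x : X) :
    eval f x = val (f.hom x) 1 := rfl

lemma eval_mem {X : ModuleCat.{u} (Hecke b k)} (f : X ⟶ coindObj b k ρ) :
    eval f ∈ (Representation.linHom (resW X) ρ).invariants := by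
  rw [Representation.mem_invariants_linHom_iff]
  intro w x
  rw [eval_apply, eval_apply, resW_apply, map_smul, val_smul_apply, one_mul, ← val_t_mul, mul_one]

/-- Frobenius reciprocity. -/
def homEquiv (X : ModuleCat.{u} (Hecke b k)) (ρ : Representation ℂ P.weylGroup U) :
    (X ⟶ coindObj b k ρ) ≃ₗ[ℂ] (Representation.linHom (resW X) ρ).invariants where
  toLinearMap := eval.codRestrict _ eval_mem
  invFun ψ := lift ψ.1 ψ.2
  left_inv f := by
    ext x
    refine Coind.ext fun h => ?_
    change val (f.hom (h • x)) 1 = val (f.hom x) h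
    rw [map_smul, val_smul_apply, one_mul]
  right_inv ψ := by
    refine Subtype.ext (LinearMap.ext fun x => ?_)
    change ψ.1 ((1 : Hecke b k) • x) = ψ.1 x
    rw [one_smul]

@[simp] lemma coe_homEquiv {X : ModuleCat.{u} (Hecke b k)} (f : X ⟶ coindObj b k ρ) :
    (homEquiv X ρ f : X →ₗ[ℂ] U) = eval f := rfl

/-- By Frobenius reciprocity one has to extend a W-equivariant map along an injection: extend it
linearly, then average over W. -/
instance injective [Finite P.weylGroup] : Injective (coindObj b k ρ) where
  factors {X Y} g f _ := by
    have := Fintype.ofFinite P.weylGroup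
    have : Invertible (Fintype.card P.weylGroup : ℂ) :=
      invertibleOfNonzero (Nat.cast_ne_zero.mpr Fintype.card_ne_zero)
    let F : X →ₗ[ℂ] Y := f.hom.restrictScalars ℂ
    obtain ⟨r, hr⟩ := F.exists_leftInverse_of_injective
      (LinearMap.ker_eq_bot.mpr ((ModuleCat.mono_iff_injective f).mp inferInstance))
    let ψ := Representation.averageMap (Representation.linHom (resW Y) ρ) (eval g ∘ₗ r)
    refine ⟨lift ψ (Representation.averageMap_invariant _ _), ?_⟩
    apply (homEquiv X ρ).injective
    refine Subtype.ext ?_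
    rw [coe_homEquiv, coe_homEquiv]
    have h1 : eval (f ≫ lift ψ (Representation.averageMap_invariant _ _)) = ψ ∘ₗ F :=
      LinearMap.ext fun x => congrArg ψ (one_smul (Hecke b k) (f.hom x))
    have h2 : ψ ∘ₗ F
        = Representation.averageMap (Representation.linHom (resW X) ρ) ((eval g ∘ₗ r) ∘ₗ F) := by
      refine LinearMap.ext fun x => ?_
      have h3 : ∀ (w : P.weylGroup), resW Y w (F x) = F (resW X w x) := fun w =>
        (map_smul f.hom (Hecke.t b k w) x).symm
      rw [Representation.averageMap_apply, LinearMap.comp_apply]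
      simp only [ψ, Representation.averageMap_apply]
      simp [h3]
    rw [h1, h2, LinearMap.comp_assoc, hr, LinearMap.comp_id]
    exact Representation.averageMap_id _ _ (eval_mem g)

section Functorial

variable {U' : Type u} [AddCommGroup U'] [Module ℂ U'] {ρ' : Representation ℂ P.weylGroup U'}

/-- The homomorphism of coinduced modules given by an operation on linear maps which commutes with
right translations and preserves equivariance. -/
def map (d : (Hecke b k →ₗ[ℂ] U) →ₗ[ℂ] (Hecke b k →ₗ[ℂ] U'))
    (hd : ∀ φ ∈ coindSubmodule b k ρ, d φ ∈ coindSubmodule b k ρ')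
    (hr : ∀ φ a, d (φ ∘ₗ LinearMap.mulRight ℂ a) = d φ ∘ₗ LinearMap.mulRight ℂ a) :
    coindObj b k ρ ⟶ coindObj b k ρ' := ModuleCat.ofHom
  { toFun := fun φ => mk (d (val φ)) (hd _ (val_mem φ))
    map_add' := fun φ ψ => Coind.ext fun _ => LinearMap.congr_fun (map_add d (val φ) (val ψ)) _
    map_smul' := fun a φ => Coind.ext fun _ => LinearMap.congr_fun (hr (val φ) a) _ }

end Functorial

section Twist

variable [P.IsReduced] (hk : IsParameter b k) {δ : P.Aut}
  (hδ : IsDiagramInvolution b δ) (hin : InducesInner P δ)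

lemma comp_twist_mem {D : Module.End ℂ U} (hD : ∀ w x, D (ρ (weylConj δ w) x) = ρ w (D x))
    (φ : coindObj b k ρ) :
    D ∘ₗ val φ ∘ₗ (Hecke.twist hk hδ hin).toLinearMap ∈ coindSubmodule b k ρ := fun w h => by
  simp only [LinearMap.comp_apply, AlgHom.toLinearMap_apply, map_mul, Hecke.twist_t, val_t_mul, hD]

/-- The action of `δ` on the coinduced module of a representation of `W ⋊ ⟨δ⟩`. -/
def twistEnd (D : Module.End ℂ U) (hD : ∀ w x, D (ρ (weylConj δ w) x) = ρ w (D x)) :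
    Module.End ℂ (coindObj b k ρ) where
  toFun φ := mk _ (comp_twist_mem hk hδ hin hD φ)
  map_add' φ ψ := Coind.ext fun h => map_add D _ _
  map_smul' c φ := Coind.ext fun h => by
    have h1 := LinearMap.congr_fun (val_complex_smul c φ) (Hecke.twist hk hδ hin h)
    have h2 := LinearMap.congr_fun (val_complex_smul c (mk _ (comp_twist_mem hk hδ hin hD φ))) h
    exact (congrArg D h1).trans ((map_smul D c _).trans h2.symm)

@[simp] lemma val_twistEnd (D : Module.End ℂ U) (hD : ∀ w x, D (ρ (weylConj δ w) x) = ρ w (D x))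
    (φ : coindObj b k ρ) (h : Hecke b k) :
    val (twistEnd hk hδ hin D hD φ) h = D (val φ (Hecke.twist hk hδ hin h)) := rfl

lemma isTwistAction_twistEnd {D : Module.End ℂ U} (hD : ∀ w x, D (ρ (weylConj δ w) x) = ρ w (D x))
    (hDD : D * D = 1) :
    IsTwistAction hk hδ hin (coindObj b k ρ) (twistEnd hk hδ hin D hD) where
  mul_self := LinearMap.ext fun φ => Coind.ext fun h => by
    rw [Module.End.mul_apply, val_twistEnd, val_twistEnd, Hecke.twist_twist,
      ← Module.End.mul_apply, hDD, Module.End.one_apply, Module.End.one_apply]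
  map_smul a φ := Coind.ext fun h => by
    rw [val_twistEnd, val_smul_apply, val_smul_apply, val_twistEnd,
      map_mul (Hecke.twist hk hδ hin) h, Hecke.twist_twist]

end Twist

end Coind

end Coind

section Trace

variable [Fintype P.weylGroup] [FiniteDimensional ℂ U]

/-- The trace of an operator on the `W`-equivariant maps given by composition on both sides. -/
lemma trace_restrict_invariants {A : Type*} [AddCommGroup A] [Module ℂ A] [FiniteDimensional ℂ A]
    {ρ : Representation ℂ P.weylGroup A} {τ : Representation ℂ P.weylGroup U}
    (DA : Module.End ℂ A) (DU : Module.End ℂ U)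
    (h : ∀ ψ ∈ (Representation.linHom ρ τ).invariants,
      (DU.compRight ℂ ∘ₗ LinearMap.lcomp ℂ U DA) ψ ∈ (Representation.linHom ρ τ).invariants) :
    LinearMap.trace ℂ _ ((DU.compRight ℂ ∘ₗ LinearMap.lcomp ℂ U DA).restrict h)
      = (Fintype.card P.weylGroup : ℂ)⁻¹ * ∑ w, LinearMap.trace ℂ U (DU * τ w) *
        LinearMap.trace ℂ A (ρ w⁻¹ * DA) := by
  have : Invertible (Fintype.card P.weylGroup : ℂ) :=
    invertibleOfNonzero (Nat.cast_ne_zero.mpr Fintype.card_ne_zero)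
  -- The averaging map projects onto the invariants, so the trace is that of the operator composed
  -- with it on the full Hom space; there each w contributes a product of two traces.
  rw [LinearMap.trace_restrict_eq_trace_comp_isProj (Representation.isProj_averageMap _),
    show (DU.compRight ℂ ∘ₗ LinearMap.lcomp ℂ U DA) ∘ₗ
        Representation.averageMap (Representation.linHom ρ τ)
      = (Fintype.card P.weylGroup : ℂ)⁻¹ • ∑ w, (DU * τ w).compRight ℂ ∘ₗ
        LinearMap.lcomp ℂ U (ρ w⁻¹ * DA) from ?_]
  · simp only [map_smul, map_sum, LinearMap.trace_compRight_comp_lcomp, smul_eq_mul]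
  · refine LinearMap.ext fun ψ => LinearMap.ext fun x => ?_
    rw [LinearMap.comp_apply, Representation.averageMap_apply]
    rw [invOf_eq_inv]
    simp

/-- Through Ext^0 = Hom and Frobenius reciprocity, T becomes ψ ↦ DU ψ DX on the W-equivariant maps
from X to U. -/
lemma trace_ext_coind {X : ModuleCat.{u} (Hecke b k)} [FiniteDimensional ℂ X]
    {ρ : Representation ℂ P.weylGroup U} (T : Ext X (coindObj b k ρ) 0 →ₗ[ℂ] Ext X (coindObj b k ρ) 0)
    (DX : Module.End ℂ X) (DU : Module.End ℂ U)
    (hT : ∀ f : X ⟶ coindObj b k ρ, ∃ f' : X ⟶ coindObj b k ρ, T (Ext.mk₀ f) = Ext.mk₀ f' ∧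
      Coind.eval f' = DU ∘ₗ Coind.eval f ∘ₗ DX) :
    LinearMap.trace ℂ _ T = (Fintype.card P.weylGroup : ℂ)⁻¹ * ∑ w,
      LinearMap.trace ℂ U (DU * ρ w) * LinearMap.trace ℂ X (resW X w⁻¹ * DX) := by
  have hinv : ∀ ψ ∈ (Representation.linHom (resW X) ρ).invariants,
      (DU.compRight ℂ ∘ₗ LinearMap.lcomp ℂ U DX) ψ
        ∈ (Representation.linHom (resW X) ρ).invariants := by
    intro ψ hψ
    obtain ⟨f, hf⟩ := (Coind.homEquiv X ρ).surjective ⟨ψ, hψ⟩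
    obtain ⟨f', -, h'⟩ := hT f
    have := Coind.eval_mem f'
    rw [h', ← Coind.coe_homEquiv, hf] at this
    exact this
  rw [← trace_restrict_invariants DX DU hinv,
    ← LinearMap.trace_conj' T (Ext.linearEquiv₀.trans (Coind.homEquiv X ρ))]
  congr 1
  refine LinearMap.ext fun ψ => ?_
  obtain ⟨f, rfl⟩ := (Coind.homEquiv X ρ).surjective ψ
  obtain ⟨f', h, h'⟩ := hT f
  refine Subtype.ext ?_
  have hmk : ∀ g : X ⟶ coindObj b k ρ, Ext.linearEquiv₀ (R := ℂ) (Ext.mk₀ g) = g := fun g =>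
    (Ext.linearEquiv₀ (R := ℂ)).symm_apply_eq.mp rfl |>.symm
  have h1 : (Ext.linearEquiv₀.trans (Coind.homEquiv X ρ)).symm (Coind.homEquiv X ρ f)
      = Ext.mk₀ f := by
    rw [LinearEquiv.symm_apply_eq, LinearEquiv.trans_apply, hmk]
  rw [LinearEquiv.conj_apply, LinearMap.comp_apply, LinearMap.comp_apply, LinearEquiv.coe_coe,
    LinearEquiv.coe_coe, h1, h, LinearEquiv.trans_apply, hmk]
  exact h'

omit [Fintype P.weylGroup] in
lemma finiteDimensional_ext_coind (X : ModuleCat.{u} (Hecke b k)) [FiniteDimensional ℂ X]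
    (ρ : Representation ℂ P.weylGroup U) : FiniteDimensional ℂ (Ext X (coindObj b k ρ) 0) :=
  Module.Finite.equiv (Ext.linearEquiv₀.trans (Coind.homEquiv X ρ)).symm

end Trace

end

end GradedHecke

/-! ### The Koszul coresolution of a module by coinduced modules. -/

namespace GradedHecke

noncomputable section

variable {ι V N : Type u} [AddCommGroup V] [Module ℝ V] [AddCommGroup N] [Module ℝ N]
  {P : RootPairing ι ℝ V N} {b : P.Base} {k : b.support → ℝ}

variable (b k) in
/-- The action of `V` on `ℍ` by left multiplication. -/
def leftV : Cx V →ₗ[ℂ] Module.End ℂ (Hecke b k) := LinearMap.mul ℂ (Hecke b k) ∘ₗ Hecke.f b k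

@[simp] lemma leftV_apply (v : Cx V) (h : Hecke b k) : leftV b k v h = Hecke.f b k v * h := rfl

/-- The action of `V` on an `ℍ`-module. -/
def actV (Y : ModuleCat.{u} (Hecke b k)) : Cx V →ₗ[ℂ] Module.End ℂ Y :=
  (Algebra.lsmul ℂ ℂ Y).toLinearMap ∘ₗ Hecke.f b k

@[simp] lemma actV_apply (Y : ModuleCat.{u} (Hecke b k)) (v : Cx V) (y : Y) :
    actV Y v y = Hecke.f b k v • y := rfl

lemma actV_comm (Y : ModuleCat.{u} (Hecke b k)) (v v' : Cx V) (y : Y) :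
    actV Y v (actV Y v' y) = actV Y v' (actV Y v y) := by
  rw [actV_apply, actV_apply, actV_apply, actV_apply, smul_smul, smul_smul, Hecke.f_comm]

lemma leftV_comm (v v' : Cx V) (h : Hecke b k) :
    leftV b k v (leftV b k v' h) = leftV b k v' (leftV b k v h) := by
  simp only [leftV_apply, ← mul_assoc, Hecke.f_comm b k v]

/-- The representation of `W` on the alternating maps with values in an `ℍ`-module. -/
def altRep (Y : ModuleCat.{u} (Hecke b k)) (n : ℕ) :
    Representation ℂ P.weylGroup (Cx V [⋀^Fin n]→ₗ[ℂ] Y) where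
  toFun w := AlternatingMap.sandwich n (resW Y w) (cxAct ((w⁻¹ : P.weylGroup) : P.Aut))
  map_one' := by
    ext ω v
    simp [cxAct_one_apply]
  map_mul' w w' := by
    rw [AlternatingMap.sandwich_mul, map_mul]
    congr 1
    refine LinearMap.ext fun v => ?_
    rw [Module.End.mul_apply, ← cxAct_mul_apply, ← Subgroup.coe_mul, mul_inv_rev]

lemma altRep_apply (Y : ModuleCat.{u} (Hecke b k)) (n : ℕ) (w : P.weylGroup)
    (ω : Cx V [⋀^Fin n]→ₗ[ℂ] Y) (v : Fin n → Cx V) :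
    altRep Y n w ω v
      = Hecke.t b k w • ω fun i => cxAct ((w⁻¹ : P.weylGroup) : P.Aut) (v i) := rfl

lemma altRep_eq (Y : ModuleCat.{u} (Hecke b k)) (n : ℕ) (w : P.weylGroup) :
    altRep Y n w = AlternatingMap.sandwich n (resW Y w) (cxAct ((w⁻¹ : P.weylGroup) : P.Aut)) := rfl

section Differential

variable [Finite ι] [P.IsCrystallographic] [P.IsReduced] [FiniteDimensional ℝ V]
  (Y : ModuleCat.{u} (Hecke b k)) {n : ℕ}

-- Moving f_v past t_s costs k_i ⟨v, α_i^∨⟩, both inside φ and on Y. The total error is k_i times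
-- the exterior product of α_i^∨ with η = φ(h) - φ(h) ∘ s_i. As s_i fixes the kernel of α_i^∨, η
-- vanishes there and the product is zero.
omit [Finite ι] [P.IsCrystallographic] [P.IsReduced] in
lemma koszulD_simpleRefl_mul {φ : Hecke b k →ₗ[ℂ] Cx V [⋀^Fin n]→ₗ[ℂ] Y}
    (hφ : φ ∈ coindSubmodule b k (altRep Y n)) (i : b.support) (h : Hecke b k) :
    koszulD (leftV b k) (actV Y) n φ (Hecke.t b k (simpleRefl P i) * h)
      = altRep Y (n + 1) (simpleRefl P i) (koszulD (leftV b k) (actV Y) n φ h) := by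
  obtain ⟨F, hF, hd⟩ := exists_koszulD_eq (leftV b k) (actV Y) φ
  set S := cxAct (simpleRefl P i : P.Aut) with hS
  let η : Cx V [⋀^Fin n]→ₗ[ℂ] Y := φ h - (φ h).compLinearMap S
  let G : Cx V →ₗ[ℂ] Cx V [⋀^Fin n]→ₗ[ℂ] Y := altRep Y n (simpleRefl P i) ∘ₗ F h ∘ₗ S
  have hss : Hecke.t b k (simpleRefl P i) * Hecke.t b k (simpleRefl P i) = 1 := by
    rw [← map_mul, simpleRefl_mul_self, map_one]
  have hcross := mul_reflection_of_cross hss (Hecke.cross b k i)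
  have h1 : F (Hecke.t b k (simpleRefl P i) * h)
      = G + (k i : ℂ) • (cxCoroot P i).smulRight η := by
    refine LinearMap.ext fun v => AlternatingMap.ext fun u => ?_
    rw [hF, leftV_apply, ← mul_assoc, hcross, add_mul, map_add, mul_assoc, hφ, hφ,
      ← Algebra.smul_def, map_smul]
    simp only [G, η, LinearMap.add_apply, LinearMap.comp_apply, LinearMap.smul_apply,
      LinearMap.smulRight_apply, AlternatingMap.add_apply, AlternatingMap.sub_apply,
      AlternatingMap.smul_apply, LinearMap.compAlternatingMap_apply, hF, altRep_apply, actV_apply,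
      leftV_apply, smul_sub, smul_smul, hcross, add_smul, simpleRefl_inv,
      AlternatingMap.compLinearMap_apply, algebraMap_smul, hS]
    abel
  have h2 : AlternatingMap.alternatizeUncurryFin G
      = altRep Y (n + 1) (simpleRefl P i) (AlternatingMap.alternatizeUncurryFin (F h)) := by
    refine AlternatingMap.ext fun v => ?_
    simp only [AlternatingMap.alternatizeUncurryFin_apply, altRep_apply, G, LinearMap.comp_apply,
      simpleRefl_inv, Finset.smul_sum]
    refine Finset.sum_congr rfl fun j _ => ?_
    rw [smul_comm]
    rfl
  rw [hd, LinearMap.comp_apply, LinearMap.comp_apply, h1, map_add, map_smul,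
    AlternatingMap.alternatizeUncurryFinLM_apply, AlternatingMap.alternatizeUncurryFinLM_apply,
    AlternatingMap.alternatizeUncurryFinLM_apply, h2,
    AlternatingMap.alternatizeUncurryFin_smulRight_eq_zero (cxCoroot P i) η
      (a := (1 : ℂ) ⊗ₜ[ℝ] P.root i) (by rw [cxCoroot_root_self]; exact two_ne_zero), smul_zero,
    add_zero]
  intro v hv
  have : ∀ j, S (v j) = v j := fun j => by rw [hS, cxAct_simpleRefl, hv j, zero_smul, sub_zero]
  simp [η, this]

lemma koszulD_mem_coindSubmodule {φ : Hecke b k →ₗ[ℂ] Cx V [⋀^Fin n]→ₗ[ℂ] Y}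
    (hφ : φ ∈ coindSubmodule b k (altRep Y n)) :
    koszulD (leftV b k) (actV Y) n φ ∈ coindSubmodule b k (altRep Y (n + 1)) := by
  intro w
  induction w using weylGroup_induction_simpleRefl b with
  | one => intro h; simp
  | mul i hi w ih =>
    intro h
    rw [map_mul (Hecke.t b k), mul_assoc, koszulD_simpleRefl_mul Y hφ ⟨i, hi⟩, ih, map_mul,
      Module.End.mul_apply]

/-- The differential of the Koszul coresolution by coinduced modules. -/
def coindD (n : ℕ) : coindObj b k (altRep Y n) ⟶ coindObj b k (altRep Y (n + 1)) :=
  Coind.map (koszulD (leftV b k) (actV Y) n) (fun _ hφ => koszulD_mem_coindSubmodule Y hφ)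
    (fun φ a => koszulD_comp (LinearMap.mulRight ℂ a) (fun _ _ => mul_assoc _ _ _) φ)

@[simp] lemma val_coindD (φ : coindObj b k (altRep Y n)) :
    Coind.val ((coindD Y n).hom φ) = koszulD (leftV b k) (actV Y) n (Coind.val φ) := rfl

lemma coindD_coindD (φ : coindObj b k (altRep Y n)) :
    (coindD Y (n + 1)).hom ((coindD Y n).hom φ) = 0 := by
  refine Coind.ext fun h => ?_
  rw [val_coindD, val_coindD, koszulD_koszulD leftV_comm (actV_comm Y)]
  rfl

/-- A cocycle is restricted to S(V), where the polynomial Koszul complex provides a primitive, and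
the primitive is extended equivariantly to ℍ. Its differential is equivariant and agrees with the
cocycle on S(V), hence everywhere. -/
lemma exists_coindD_eq (hk : IsParameter b k) {φ : coindObj b k (altRep Y (n + 1))}
    (hφ : (coindD Y (n + 1)).hom φ = 0) : ∃ ψ, (coindD Y n).hom ψ = φ := by
  cases nonempty_fintype ι
  let e := Module.finBasis ℂ (Cx V)
  have hp : ∀ v p, (polyMap b k e).toLinearMap (linPolyMul e v p)
      = leftV b k v ((polyMap b k e).toLinearMap p) := fun v p => by simp
  obtain ⟨ψ₀, hψ₀⟩ := exists_koszulD_eq_of_koszulD_eq_zero e (actV_comm Y)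
    (Coind.val φ ∘ₗ (polyMap b k e).toLinearMap) (by
      rw [koszulD_comp (L := leftV b k) _ hp, ← val_coindD, hφ, Coind.val_zero,
        LinearMap.zero_comp])
  obtain ⟨ψ, hψ, hψ'⟩ := exists_equivariant_extension e (altRep Y n) hk ψ₀
  refine ⟨Coind.mk ψ hψ, Subtype.ext ?_⟩
  refine eq_of_equivariant_of_polyMap e _ (Coind.val_t_mul ((coindD Y n).hom (Coind.mk ψ hψ)))
    (Coind.val_t_mul φ) fun p => ?_
  have h1 := LinearMap.congr_fun (koszulD_comp (L := leftV b k) (R := actV Y) _ hp ψ) p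
  have h2 : ψ ∘ₗ (polyMap b k e).toLinearMap = ψ₀ := LinearMap.ext hψ'
  rw [h2, hψ₀] at h1
  exact h1.symm

/-- The cocycles of the Koszul coresolution. -/
def cocycles (n : ℕ) : ModuleCat.{u} (Hecke b k) :=
  ModuleCat.of (Hecke b k) (LinearMap.ker (coindD Y n).hom)

/-- The inclusion of the cocycles. -/
def cocyclesι (n : ℕ) : cocycles Y n ⟶ coindObj b k (altRep Y n) :=
  ModuleCat.ofHom (X := LinearMap.ker (coindD Y n).hom) (LinearMap.ker (coindD Y n).hom).subtype

/-- The differential of the Koszul coresolution, as a map to the cocycles. -/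
def toCocycles (n : ℕ) : coindObj b k (altRep Y n) ⟶ cocycles Y (n + 1) :=
  ModuleCat.ofHom (Y := LinearMap.ker (coindD Y (n + 1)).hom)
    ((coindD Y n).hom.codRestrict _ fun φ => coindD_coindD Y φ)

lemma cocyclesι_injective (n : ℕ) : Function.Injective (cocyclesι Y n).hom :=
  Subtype.val_injective

lemma coindD_cocyclesι (z : cocycles Y n) : (coindD Y n).hom ((cocyclesι Y n).hom z) = 0 := z.2

lemma cocyclesι_comp_toCocycles (n : ℕ) : cocyclesι Y n ≫ toCocycles Y n = 0 := by
  ext z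
  exact cocyclesι_injective Y (n + 1) (coindD_cocyclesι Y z)

lemma exists_cocyclesι_eq {φ : coindObj b k (altRep Y n)} (h : (coindD Y n).hom φ = 0) :
    ∃ z, (cocyclesι Y n).hom z = φ := ⟨⟨φ, h⟩, rfl⟩

lemma cocycles_shortExact (hk : IsParameter b k) (n : ℕ) :
    (ShortComplex.mk _ _ (cocyclesι_comp_toCocycles Y n)).ShortExact where
  exact := by
    rw [ShortComplex.moduleCat_exact_iff]
    intro φ hφ
    exact exists_cocyclesι_eq Y (congrArg (cocyclesι Y (n + 1)).hom hφ)
  mono_f := (ModuleCat.mono_iff_injective _).mpr (cocyclesι_injective Y n)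
  epi_g := (ModuleCat.epi_iff_surjective _).mpr fun z => by
    obtain ⟨ψ, hψ⟩ := exists_coindD_eq Y hk (coindD_cocyclesι Y z)
    exact ⟨ψ, cocyclesι_injective Y (n + 1) hψ⟩

lemma isZero_cocycles (hn : Module.finrank ℝ V < n) : Limits.IsZero (cocycles Y n) := by
  have : Subsingleton (cocycles Y n) := by
    refine ⟨fun z z' => cocyclesι_injective Y n (Coind.ext fun h => ?_)⟩
    have hn' : Module.finrank ℂ (Cx V) < n := by rwa [Module.finrank_baseChange]
    rw [AlternatingMap.eq_zero_of_finrank_lt hn' (Coind.val _ h),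
      AlternatingMap.eq_zero_of_finrank_lt hn' (Coind.val _ h)]
  exact ModuleCat.isZero_of_subsingleton _

/-- The inclusion `y ↦ (h ↦ h y)` of an `ℍ`-module in a coinduced module. -/
def augmentation : Y ⟶ coindObj b k (altRep Y 0) :=
  Coind.lift
    { toFun := fun y => AlternatingMap.constOfIsEmpty ℂ (Cx V) (Fin 0) y
      map_add' := fun _ _ => rfl
      map_smul' := fun _ _ => rfl }
    (Representation.mem_invariants_linHom_iff.mpr fun _ _ => rfl)

omit [Finite ι] [P.IsCrystallographic] [P.IsReduced] [FiniteDimensional ℝ V] in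
lemma val_augmentation_apply (y : Y) (h : Hecke b k) (v : Fin 0 → Cx V) :
    Coind.val ((augmentation Y).hom y) h v = h • y := rfl

lemma coindD_augmentation (y : Y) : (coindD Y 0).hom ((augmentation Y).hom y) = 0 := by
  refine Coind.ext fun h => AlternatingMap.ext fun v => ?_
  rw [val_coindD, koszulD_apply]
  simp [val_augmentation_apply, mul_smul]

/-- Being coinduced means commuting with all t_w, and being a cocycle of degree zero means commuting
with all f_v. Such a map ℍ → Y is ℍ-linear and determined by its value at 1. -/
lemma val_eq_smul_of_coindD_eq_zero {φ : coindObj b k (altRep Y 0)}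
    (hφ : (coindD Y 0).hom φ = 0) (h : Hecke b k) (v : Fin 0 → Cx V) :
    Coind.val φ h v = h • Coind.val φ 1 v := by
  have key : ∀ h h' : Hecke b k, Coind.val φ (h * h') v = h • Coind.val φ h' v := by
    intro h
    induction h using Hecke.induction with
    | ht w =>
      intro h'
      rw [Coind.val_t_mul, altRep_apply]
      congr 2
      exact Subsingleton.elim _ _
    | hf u =>
      intro h'
      have h1 := congrArg (fun ψ : coindObj b k (altRep Y 1) => Coind.val ψ h' ![u]) hφ
      simp only [val_coindD, koszulD_apply, Coind.val_zero] at h1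
      simpa [Subsingleton.elim _ v, sub_eq_zero] using h1
    | hc c => intro h'; rw [← Algebra.smul_def, map_smul, algebraMap_smul]; rfl
    | hadd x y hx hy => intro h'; rw [add_mul, map_add, AlternatingMap.add_apply, hx, hy, add_smul]
    | hmul x y hx hy => intro h'; rw [mul_assoc, hx, hy, mul_smul]
  simpa using key h 1

/-- An `ℍ`-module is the module of zero-cocycles in its Koszul coresolution. -/
def isoCocycles : Y ≅ cocycles Y 0 :=
  LinearEquiv.toModuleIso (X₂ := LinearMap.ker (coindD Y 0).hom)
    (LinearEquiv.ofBijective ((augmentation Y).hom.codRestrict _ fun y => coindD_augmentation Y y) (by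
      constructor
      · intro y y' h
        have h1 := congrArg (fun z => Coind.val ((cocyclesι Y 0).hom z) 1 ![]) h
        change (1 : Hecke b k) • y = (1 : Hecke b k) • y' at h1
        rwa [one_smul, one_smul] at h1
      · intro z
        refine ⟨Coind.val ((cocyclesι Y 0).hom z) 1 ![], cocyclesι_injective Y 0 (Coind.ext fun h =>
          AlternatingMap.ext fun v => ?_)⟩
        rw [val_eq_smul_of_coindD_eq_zero Y (coindD_cocyclesι Y z) h v, Subsingleton.elim v ![]]
        rfl))

end Differential

end

end GradedHecke

/-! ### From the coresolution to the elliptic pairing. -/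

namespace GradedHecke

noncomputable section

variable {ι V N : Type u} [AddCommGroup V] [Module ℝ V] [AddCommGroup N] [Module ℝ N]
  {P : RootPairing ι ℝ V N} {b : P.Base} {k : b.support → ℝ}

section EulerCharacteristic

variable {X Y : ModuleCat.{u} (Hecke b k)} {g : P.Aut}

/-- The square of wg lies in the finite group W because g² = 1. -/
lemma exists_pow_eq_one [Finite P.weylGroup] (hg : g * g = 1) (w : P.weylGroup) :
    ∃ m, m ≠ 0 ∧ ((w : P.Aut) * g) ^ m = 1 := by
  refine ⟨2 * Nat.card P.weylGroup, mul_ne_zero two_ne_zero Nat.card_pos.ne', ?_⟩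
  have hg' : g⁻¹ = g := inv_eq_of_mul_eq_one_left hg
  have h1 : ((w : P.Aut) * g) ^ 2 = ((w * weylConj g w : P.weylGroup) : P.Aut) := by
    rw [Subgroup.coe_mul, weylConj_coe, hg', sq]
    group
  rw [pow_mul, h1, ← Subgroup.coe_pow, pow_card_eq_one', Subgroup.coe_one]

lemma cxAct_pow (h : P.Aut) (m : ℕ) : cxAct (h ^ m) = (cxAct h : Module.End ℂ (Cx V)) ^ m := by
  induction m with
  | zero => exact LinearMap.ext cxAct_one_apply
  | succ m ih =>
    rw [pow_succ, pow_succ, ← ih]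
    exact LinearMap.ext fun v => cxAct_mul_apply _ _ v

lemma cxAct_one : cxAct (1 : P.Aut) = LinearMap.id := LinearMap.ext cxAct_one_apply

/-- The trace of `w δ` and of its inverse. -/
lemma trace_mul_resW_inv [Finite P.weylGroup] [FiniteDimensional ℂ Y] {DY : Module.End ℂ Y}
    (hDY : DY * DY = 1) (hDY' : ∀ w, DY * resW Y w = resW Y (weylConj g w) * DY)
    (w : P.weylGroup) :
    LinearMap.trace ℂ Y (DY * resW Y w⁻¹) = conj (LinearMap.trace ℂ Y (resW Y w * DY)) := by
  have h1 : (resW Y w * DY) ^ 2 = resW Y (w * weylConj g w) := by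
    rw [sq, mul_assoc, ← mul_assoc DY, hDY', mul_assoc _ DY, hDY, mul_one, map_mul]
  refine LinearMap.trace_eq_conj_trace_of_mul_eq_one (m := 2 * Nat.card P.weylGroup)
    (mul_ne_zero two_ne_zero Nat.card_pos.ne') ?_ ?_
  · rw [pow_mul, h1, ← map_pow, pow_card_eq_one', map_one]
  -- The operator on the left is the inverse of w δ, since δ is its own inverse on Y.
  · rw [mul_assoc, ← mul_assoc _ (resW Y w), ← map_mul, inv_mul_cancel, map_one, one_mul, hDY]

/-- The alternating sum of the contributions of the terms of the Koszul coresolution. -/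
lemma sum_trace_sandwich [Fintype P.weylGroup] [FiniteDimensional ℝ V] [FiniteDimensional ℂ X]
    [FiniteDimensional ℂ Y] (hg : g * g = 1) {DX : Module.End ℂ X} {DY : Module.End ℂ Y}
    (hDY : DY * DY = 1) (hDY' : ∀ w, DY * resW Y w = resW Y (weylConj g w) * DY) :
    ∑ n ∈ Finset.range (Module.finrank ℝ V + 1), (-1) ^ n * ((Fintype.card P.weylGroup : ℂ)⁻¹ *
        ∑ w, LinearMap.trace ℂ _ (AlternatingMap.sandwich n DY (cxAct g) * altRep Y n w)
          * LinearMap.trace ℂ X (resW X w⁻¹ * DX))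
      = twistedEllipticPairing g (resW X) DX (resW Y) DY := by
  have h1 : ∀ n (w : P.weylGroup),
      LinearMap.trace ℂ _ (AlternatingMap.sandwich n DY (cxAct g) * altRep Y n w)
        = LinearMap.trace ℂ Y (DY * resW Y w) * LinearMap.trace ℂ _ (exteriorPower.map n
            (cxAct (((w⁻¹ : P.weylGroup) : P.Aut) * g))) := by
    intro n w
    rw [altRep_eq, AlternatingMap.sandwich_mul, AlternatingMap.trace_sandwich]
    congr 4
    exact LinearMap.ext fun v => (cxAct_mul_apply _ _ v).symm
  rw [twistedEllipticPairing, finsum_eq_sum_of_fintype, Nat.card_eq_fintype_card]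
  simp only [h1, mul_left_comm _ (Fintype.card P.weylGroup : ℂ)⁻¹]
  rw [← Finset.mul_sum]
  congr 1
  simp only [Finset.mul_sum]
  rw [Finset.sum_comm]
  -- The substitution w ↦ w⁻¹ puts w δ into the trace on X and on the exterior powers; on Y it
  -- leaves the inverse of w δ, whose trace is the conjugate.
  refine Fintype.sum_equiv (Equiv.inv P.weylGroup) _ _ fun w => ?_
  obtain ⟨m, hm, hw⟩ := exists_pow_eq_one hg w⁻¹
  have h2 := LinearMap.sum_trace_exteriorPower_of_pow_eq_one hm
    (T := cxAct (((w⁻¹ : P.weylGroup) : P.Aut) * g)) (by rw [← cxAct_pow, hw]; exact cxAct_one)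
  rw [Module.finrank_baseChange] at h2
  rw [Equiv.inv_apply, ← trace_mul_resW_inv hDY hDY', inv_inv, ← h2, Finset.mul_sum]
  refine Finset.sum_congr rfl fun n _ => ?_
  ring

variable [Finite ι] [P.IsCrystallographic] [P.IsReduced] [FiniteDimensional ℝ V]

/-- The Euler characteristic of operators on `Ext`-groups which are compatible with operators on
the Koszul coresolution. -/
theorem ext_finite_and_sum_trace (hk : IsParameter b k) [FiniteDimensional ℂ X]
    [FiniteDimensional ℂ Y] (hg : g * g = 1) {DX : Module.End ℂ X} {DY : Module.End ℂ Y}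
    (hDY : DY * DY = 1) (hDY' : ∀ w, DY * resW Y w = resW Y (weylConj g w) * DY)
    (TY : ∀ m, Ext X Y m →ₗ[ℂ] Ext X Y m)
    (T : ∀ n m, Ext X (cocycles Y n) m →ₗ[ℂ] Ext X (cocycles Y n) m)
    (TI : ∀ n, Ext X (coindObj b k (altRep Y n)) 0 →ₗ[ℂ] Ext X (coindObj b k (altRep Y n)) 0)
    (hTY : ∀ m (α : Ext X Y m), T 0 m (α.comp (Ext.mk₀ (isoCocycles Y).hom) (add_zero m))
      = (TY m α).comp (Ext.mk₀ (isoCocycles Y).hom) (add_zero m))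
    (hf : ∀ n (α : Ext X (cocycles Y n) 0), TI n (α.comp (Ext.mk₀ (cocyclesι Y n)) (add_zero 0))
      = (T n 0 α).comp (Ext.mk₀ (cocyclesι Y n)) (add_zero 0))
    (hg' : ∀ n (α : Ext X (coindObj b k (altRep Y n)) 0),
      T (n + 1) 0 (α.comp (Ext.mk₀ (toCocycles Y n)) (add_zero 0))
        = (TI n α).comp (Ext.mk₀ (toCocycles Y n)) (add_zero 0))
    (hδ : ∀ n m (α : Ext X (cocycles Y (n + 1)) m),
      T n (m + 1) (α.comp (cocycles_shortExact Y hk n).extClass rfl)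
        = (T (n + 1) m α).comp (cocycles_shortExact Y hk n).extClass rfl)
    (hTI : ∀ n (f : X ⟶ coindObj b k (altRep Y n)), ∃ f' : X ⟶ coindObj b k (altRep Y n),
      TI n (Ext.mk₀ f) = Ext.mk₀ f' ∧
        Coind.eval f' = AlternatingMap.sandwich n DY (cxAct g) ∘ₗ Coind.eval f ∘ₗ DX) :
    (∀ n : ℕ, FiniteDimensional ℂ (Ext X Y n)) ∧
      (∀ n : ℕ, Module.finrank ℝ V < n → Subsingleton (Ext X Y n)) ∧
      ∑ᶠ n : ℕ, (-1) ^ n * LinearMap.trace ℂ (Ext X Y n) (TY n)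
        = twistedEllipticPairing g (resW X) DX (resW Y) DY := by
  have := finite_weylGroup P
  have := Fintype.ofFinite P.weylGroup
  -- The length is dim V + 1: this is the first degree without nonzero alternating forms.
  obtain ⟨h1, h2, h3⟩ := Ext.finite_and_sum_trace_of_injective_coresolution (K := ℂ) X
    (Module.finrank ℝ V + 1) (cocycles Y) (fun n => coindObj b k (altRep Y n)) (cocyclesι Y)
    (toCocycles Y) (cocyclesι_comp_toCocycles Y) (cocycles_shortExact Y hk)
    (fun n => inferInstance) (isZero_cocycles Y (Nat.lt_succ_self _))
    (fun n => finiteDimensional_ext_coind X _) T TI hf hg' hδ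
  have hsub : ∀ n : ℕ, Module.finrank ℝ V < n → Subsingleton (Ext X Y n) := fun n hn => by
    have := h2 n hn
    exact (Ext.postcompIso ℂ X (isoCocycles Y) n).toEquiv.subsingleton
  refine ⟨fun n => Module.Finite.equiv (Ext.postcompIso ℂ X (isoCocycles Y) n).symm, hsub, ?_⟩
  rw [finsum_eq_sum_of_support_subset (s := Finset.range (Module.finrank ℝ V + 1)),
    ← sum_trace_sandwich hg hDY hDY']
  · simp only [Ext.trace_eq_of_iso (isoCocycles Y) (hTY _)]
    rw [h3]
    refine Finset.sum_congr rfl fun n _ => ?_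
    rw [trace_ext_coind (TI n) DX _ (hTI n)]
  · intro n hn
    rw [Finset.coe_range, Set.mem_Iio]
    by_contra hlt
    have := hsub n (by omega)
    refine hn ?_
    beta_reduce
    rw [Subsingleton.elim (TY n) 0, map_zero, mul_zero]

end EulerCharacteristic

/-! ### The action of δ on the Koszul coresolution. -/

section Twist

lemma weylConj_weylConj {δ : P.Aut} (hδ : IsDiagramInvolution b δ) (w : P.weylGroup) :
    weylConj δ (weylConj δ w) = w := by
  apply Subtype.ext
  have h1 : δ⁻¹ = δ := inv_eq_of_mul_eq_one_left hδ.mul_self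
  rw [weylConj_coe, weylConj_coe, h1,
    show δ * (δ * (w : P.Aut) * δ) * δ = (δ * δ) * w * (δ * δ) by group, hδ.mul_self]
  simp

variable [P.IsReduced] {hk : IsParameter b k} {δ : P.Aut} {hδ : IsDiagramInvolution b δ}
  {hin : InducesInner P δ} {X Y : ModuleCat.{u} (Hecke b k)} {DX : Module.End ℂ X}
  {DY : Module.End ℂ Y}

namespace IsTwistAction

lemma mul_resW (hY : IsTwistAction hk hδ hin Y DY) (w : P.weylGroup) :
    DY * resW Y w = resW Y (weylConj δ w) * DY := by
  refine LinearMap.ext fun y => ?_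
  rw [Module.End.mul_apply, Module.End.mul_apply, resW_apply, resW_apply, hY.map_smul,
    Hecke.twist_t]

/-- Together with `sandwich_mul_self` this makes Alt^n(V, Y) a representation of W ⋊ ⟨δ⟩, so that
its coinduced module carries an action of δ. -/
lemma sandwich_altRep (hY : IsTwistAction hk hδ hin Y DY) (n : ℕ) (w : P.weylGroup)
    (ω : Cx V [⋀^Fin n]→ₗ[ℂ] Y) :
    AlternatingMap.sandwich n DY (cxAct δ) (altRep Y n (weylConj δ w) ω)
      = altRep Y n w (AlternatingMap.sandwich n DY (cxAct δ) ω) := by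
  rw [altRep_eq, altRep_eq, ← Module.End.mul_apply, ← Module.End.mul_apply,
    AlternatingMap.sandwich_mul, AlternatingMap.sandwich_mul, hY.mul_resW,
    weylConj_weylConj hδ]
  congr 2
  refine LinearMap.ext fun v => ?_
  rw [Module.End.mul_apply, Module.End.mul_apply, ← cxAct_mul_apply, ← cxAct_mul_apply,
    ← map_inv, weylConj_coe, inv_mul_cancel_right]

lemma sandwich_mul_self (hY : IsTwistAction hk hδ hin Y DY) (n : ℕ) :
    AlternatingMap.sandwich n DY (cxAct δ) * AlternatingMap.sandwich n DY (cxAct δ) = 1 := by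
  rw [AlternatingMap.sandwich_mul, hY.mul_self]
  ext ω v
  simp [← cxAct_mul_apply, hδ.mul_self, cxAct_one_apply]

/-- The action of `δ` on the terms of the Koszul coresolution. -/
def coindEnd (hY : IsTwistAction hk hδ hin Y DY) (n : ℕ) :
    Module.End ℂ (coindObj b k (altRep Y n)) :=
  Coind.twistEnd hk hδ hin (AlternatingMap.sandwich n DY (cxAct δ)) (hY.sandwich_altRep n)

lemma val_coindEnd (hY : IsTwistAction hk hδ hin Y DY) (n : ℕ) (φ : coindObj b k (altRep Y n))
    (h : Hecke b k) (v : Fin n → Cx V) :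
    Coind.val (hY.coindEnd n φ) h v
      = DY (Coind.val φ (Hecke.twist hk hδ hin h) fun i => cxAct δ (v i)) := rfl

lemma isTwistAction_coindEnd (hY : IsTwistAction hk hδ hin Y DY) (n : ℕ) :
    IsTwistAction hk hδ hin (coindObj b k (altRep Y n)) (hY.coindEnd n) :=
  Coind.isTwistAction_twistEnd hk hδ hin _ (hY.sandwich_mul_self n)

variable [Finite ι] [P.IsCrystallographic] [FiniteDimensional ℝ V]

/-- Both terms of the differential transform correctly because δ sends f_v to f_{δ(v)} in ℍ and in
its action on Y, while δ² = 1. -/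
lemma coindD_coindEnd (hY : IsTwistAction hk hδ hin Y DY) (n : ℕ)
    (φ : coindObj b k (altRep Y n)) :
    (coindD Y n).hom (hY.coindEnd n φ) = hY.coindEnd (n + 1) ((coindD Y n).hom φ) := by
  refine Coind.ext fun h => AlternatingMap.ext fun v => ?_
  rw [val_coindEnd, val_coindD, val_coindD, koszulD_apply, koszulD_apply, map_sum]
  refine Finset.sum_congr rfl fun j _ => ?_
  rw [map_zsmul, map_sub, val_coindEnd, val_coindEnd, leftV_apply, leftV_apply, actV_apply,
    actV_apply, hY.map_smul, map_mul, Hecke.twist_f, Hecke.twist_f, ← cxAct_mul_apply,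
    hδ.mul_self, cxAct_one_apply]
  rfl

lemma coindEnd_mem_ker (hY : IsTwistAction hk hδ hin Y DY) {n : ℕ} (z : cocycles Y n) :
    hY.coindEnd n ((cocyclesι Y n).hom z) ∈ LinearMap.ker (coindD Y n).hom := by
  rw [LinearMap.mem_ker, coindD_coindEnd, coindD_cocyclesι, map_zero]

/-- The action of `δ` on the cocycles of the Koszul coresolution. -/
def cocyclesEnd (hY : IsTwistAction hk hδ hin Y DY) (n : ℕ) : Module.End ℂ (cocycles Y n) where
  toFun z := (⟨_, hY.coindEnd_mem_ker z⟩ : LinearMap.ker (coindD Y n).hom)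
  map_add' z z' := cocyclesι_injective Y n
    ((congrArg (hY.coindEnd n) (map_add (cocyclesι Y n).hom z z')).trans (map_add _ _ _))
  map_smul' c z := cocyclesι_injective Y n
    ((congrArg (hY.coindEnd n) (((cocyclesι Y n).hom.restrictScalars ℂ).map_smul c z)).trans
      ((_root_.map_smul (hY.coindEnd n) c _).trans
        (((cocyclesι Y n).hom.restrictScalars ℂ).map_smul c
          (⟨_, hY.coindEnd_mem_ker z⟩ : LinearMap.ker (coindD Y n).hom)).symm))

lemma cocyclesι_cocyclesEnd (hY : IsTwistAction hk hδ hin Y DY) (n : ℕ) (z : cocycles Y n) :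
    (cocyclesι Y n).hom (hY.cocyclesEnd n z) = hY.coindEnd n ((cocyclesι Y n).hom z) := rfl

lemma isTwistAction_cocyclesEnd (hY : IsTwistAction hk hδ hin Y DY) (n : ℕ) :
    IsTwistAction hk hδ hin (cocycles Y n) (hY.cocyclesEnd n) where
  mul_self := LinearMap.ext fun z => cocyclesι_injective Y n (by
    rw [Module.End.mul_apply, cocyclesι_cocyclesEnd, cocyclesι_cocyclesEnd,
      ← Module.End.mul_apply, (hY.isTwistAction_coindEnd n).mul_self, Module.End.one_apply,
      Module.End.one_apply])
  map_smul a z := cocyclesι_injective Y n (by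
    rw [cocyclesι_cocyclesEnd, _root_.map_smul (cocyclesι Y n).hom,
      _root_.map_smul (cocyclesι Y n).hom, (hY.isTwistAction_coindEnd n).map_smul,
      cocyclesι_cocyclesEnd])

lemma toCocycles_coindEnd (hY : IsTwistAction hk hδ hin Y DY) (n : ℕ)
    (φ : coindObj b k (altRep Y n)) :
    (toCocycles Y n).hom (hY.coindEnd n φ) = hY.cocyclesEnd (n + 1) ((toCocycles Y n).hom φ) :=
  cocyclesι_injective Y (n + 1) (hY.coindD_coindEnd n φ)

lemma isoCocycles_hom (hY : IsTwistAction hk hδ hin Y DY) (y : Y) :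
    (isoCocycles Y).hom.hom (DY y) = hY.cocyclesEnd 0 ((isoCocycles Y).hom.hom y) := by
  refine cocyclesι_injective Y 0 (Coind.ext fun h => AlternatingMap.ext fun v => ?_)
  rw [cocyclesι_cocyclesEnd, val_coindEnd]
  change h • DY y = DY (Hecke.twist hk hδ hin h • y)
  rw [hY.map_smul, Hecke.twist_twist]

-- Since δ fixes 1 in ℍ, evaluation at 1 carries δ^* to ψ ↦ δ ψ δ on W-equivariant maps.
omit [Finite ι] [P.IsCrystallographic] [FiniteDimensional ℝ V] in
lemma extTwist_mk₀_coind (hX : IsTwistAction hk hδ hin X DX) (hY : IsTwistAction hk hδ hin Y DY)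
    (n : ℕ) (f : X ⟶ coindObj b k (altRep Y n)) :
    ∃ f' : X ⟶ coindObj b k (altRep Y n),
      extTwist hX (hY.isTwistAction_coindEnd n) 0 (Ext.mk₀ f) = Ext.mk₀ f' ∧
        Coind.eval f' = AlternatingMap.sandwich n DY (cxAct δ) ∘ₗ Coind.eval f ∘ₗ DX := by
  refine ⟨hX.toTwist ≫ (twistFunctor hk hδ hin).map f ≫ (hY.isTwistAction_coindEnd n).ofTwist,
    ?_, ?_⟩
  · rw [extTwist_apply, Ext.mapExactFunctor_mk₀, Ext.mk₀_comp_mk₀, Ext.mk₀_comp_mk₀]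
  · refine LinearMap.ext fun x => AlternatingMap.ext fun v => ?_
    change Coind.val (hY.coindEnd n (f.hom (DX x))) 1 v = _
    rw [val_coindEnd, map_one]
    rfl

end IsTwistAction

variable [Finite ι] [P.IsCrystallographic] [FiniteDimensional ℝ V] [FiniteDimensional ℂ X]
  [FiniteDimensional ℂ Y]

/-- All maps of the coresolution commute with δ, so the compatibilities required of the operators
are the naturality of δ^* for homomorphisms and for connecting maps. -/
theorem twistedEulerPoincare_eq (hX : IsTwistAction hk hδ hin X DX)
    (hY : IsTwistAction hk hδ hin Y DY) :
    (∀ n : ℕ, FiniteDimensional ℂ (Ext X Y n)) ∧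
      (∀ n : ℕ, Module.finrank ℝ V < n → Subsingleton (Ext X Y n)) ∧
      twistedEulerPoincare hX hY = twistedEllipticPairing δ (resW X) DX (resW Y) DY :=
  ext_finite_and_sum_trace hk hδ.mul_self hY.mul_self hY.mul_resW (extTwist hX hY)
    (fun n => extTwist hX (hY.isTwistAction_cocyclesEnd n))
    (fun n => extTwist hX (hY.isTwistAction_coindEnd n) 0)
    (fun m α => extTwist_comp_mk₀ hX hY (hY.isTwistAction_cocyclesEnd 0) hY.isoCocycles_hom m α)
    (fun n α => extTwist_comp_mk₀ hX (hY.isTwistAction_cocyclesEnd n)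
      (hY.isTwistAction_coindEnd n) (hY.cocyclesι_cocyclesEnd n) 0 α)
    (fun n α => extTwist_comp_mk₀ hX (hY.isTwistAction_coindEnd n)
      (hY.isTwistAction_cocyclesEnd (n + 1)) (hY.toCocycles_coindEnd n) 0 α)
    (fun n m α => extTwist_comp_extClass hX (cocycles_shortExact Y hk n)
      (hY.isTwistAction_cocyclesEnd n) (hY.isTwistAction_coindEnd n)
      (hY.isTwistAction_cocyclesEnd (n + 1)) (hY.cocyclesι_cocyclesEnd n)
      (hY.toCocycles_coindEnd n) m α)
    (hX.extTwist_mk₀_coind hY)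

variable (X Y) in
-- All operators are taken to be identities, whose traces are dimensions; this avoids comparing δ^*
-- for δ = 1 with the identity of Ext.
theorem eulerPoincare_eq (hk : IsParameter b k) :
    (∀ n : ℕ, FiniteDimensional ℂ (Ext X Y n)) ∧
      (∀ n : ℕ, Module.finrank ℝ V < n → Subsingleton (Ext X Y n)) ∧
      eulerPoincare X Y = ellipticPairing P (resW X) (resW Y) := by
  have h1 : ∀ w : P.weylGroup, weylConj 1 w = w := fun w => Subtype.ext (by simp)
  obtain ⟨hfd, hsub, h⟩ := ext_finite_and_sum_trace (X := X) (Y := Y) (g := 1) (DX := 1) (DY := 1)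
    hk (mul_one 1) (mul_one 1) (fun w => by rw [h1, one_mul, mul_one]) (fun m => LinearMap.id)
    (fun n m => LinearMap.id) (fun n => LinearMap.id) (fun _ _ => rfl) (fun _ _ => rfl)
    (fun _ _ => rfl) (fun _ _ _ => rfl) (fun n f => ⟨f, rfl, by
      refine LinearMap.ext fun x => AlternatingMap.ext fun v => ?_
      simp [cxAct_one_apply]⟩)
  refine ⟨hfd, hsub, ?_⟩
  have h2 : twistedEllipticPairing (1 : P.Aut) (resW X) 1 (resW Y) 1
      = ellipticPairing P (resW X) (resW Y) := by
    simp only [twistedEllipticPairing, ellipticPairing, mul_one]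
  rw [← h2, ← h, eulerPoincare]
  refine finsum_congr fun n => ?_
  rw [LinearMap.trace_id]

end Twist

/-! ### Dependence on restrictions, special choices of δ, and the theorem. -/

section Restriction

variable {A A' : Type*} [AddCommGroup A] [Module ℂ A] [AddCommGroup A'] [Module ℂ A']

lemma trace_eq_of_intertwining {S : Module.End ℂ A} {S' : Module.End ℂ A'} (e : A ≃ₗ[ℂ] A')
    (h : ∀ x, e (S x) = S' (e x)) : LinearMap.trace ℂ A S = LinearMap.trace ℂ A' S' := by
  rw [← LinearMap.trace_conj' S e]
  congr 1
  refine LinearMap.ext fun x => ?_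
  rw [LinearEquiv.conj_apply, LinearMap.comp_apply, LinearMap.comp_apply, LinearEquiv.coe_coe,
    LinearEquiv.coe_coe, h, LinearEquiv.apply_symm_apply]

lemma ellipticPairing_congr {X Y X' Y' : ModuleCat.{u} (Hecke b k)} (h : IsoOverW X X')
    (h' : IsoOverW Y Y') :
    ellipticPairing P (resW X) (resW Y) = ellipticPairing P (resW X') (resW Y') := by
  obtain ⟨e, he⟩ := h
  obtain ⟨e', he'⟩ := h'
  simp only [ellipticPairing, trace_eq_of_intertwining e (he _),
    trace_eq_of_intertwining e' (he' _)]

lemma twistedEllipticPairing_congr {X Y X' Y' : ModuleCat.{u} (Hecke b k)} (δ : P.Aut)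
    {DX : Module.End ℂ X} {DY : Module.End ℂ Y} {DX' : Module.End ℂ X'} {DY' : Module.End ℂ Y'}
    (h : IsoOverWTwist X X' DX DX') (h' : IsoOverWTwist Y Y' DY DY') :
    twistedEllipticPairing δ (resW X) DX (resW Y) DY
      = twistedEllipticPairing δ (resW X') DX' (resW Y') DY' := by
  obtain ⟨e, he, hD⟩ := h
  obtain ⟨e', he', hD'⟩ := h'
  have h1 : ∀ w, LinearMap.trace ℂ X (resW X w * DX) = LinearMap.trace ℂ X' (resW X' w * DX') :=
    fun w => trace_eq_of_intertwining e fun x => by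
      rw [Module.End.mul_apply, he, hD, Module.End.mul_apply]
  have h2 : ∀ w, LinearMap.trace ℂ Y (resW Y w * DY) = LinearMap.trace ℂ Y' (resW Y' w * DY') :=
    fun w => trace_eq_of_intertwining e' fun x => by
      rw [Module.End.mul_apply, he', hD', Module.End.mul_apply]
  simp only [twistedEllipticPairing, h1, h2]

end Restriction

lemma inducesInner_one : InducesInner P 1 := ⟨1, one_mem _, fun _ _ => rfl⟩

/-- Since -1 is central, conjugation by δ = -w₀ is conjugation by w₀. -/
lemma IsOpposition.inducesInner {δ : P.Aut} (h : IsOpposition b δ) : InducesInner P δ := by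
  obtain ⟨w₀, hw₀, hδ⟩ := h
  refine ⟨w₀, hw₀.1, fun w _ => ?_⟩
  rw [mul_inv_eq_iff_eq_mul]
  refine aut_ext fun v => ?_
  have h1 : w₀⁻¹ • δ • v = -v := by rw [hδ, smul_neg, inv_smul_smul]
  rw [mul_smul, mul_smul, mul_smul, mul_smul, h1, smul_neg, smul_neg, hδ]

end

end GradedHecke

open GradedHecke in
theorem theorem1p1 {ι V N : Type u} [Finite ι] [AddCommGroup V] [Module ℝ V]
    [FiniteDimensional ℝ V] [AddCommGroup N] [Module ℝ N] (P : RootPairing ι ℝ V N)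
    [P.IsCrystallographic] [P.IsReduced] (b : P.Base) (k : b.support → ℝ)
    (hk : IsParameter b k) :
    -- the twisted formula, for every `δ` which induces an inner automorphism of `W`
    (∀ (δ : P.Aut) (hδ : IsDiagramInvolution b δ) (hin : InducesInner P δ)
      (X Y : ModuleCat.{u} (Hecke b k)) [FiniteDimensional ℂ X] [FiniteDimensional ℂ Y]
      (DX : Module.End ℂ X) (DY : Module.End ℂ Y)
      (hX : IsTwistAction hk hδ hin X DX) (hY : IsTwistAction hk hδ hin Y DY),
      (∀ n : ℕ, FiniteDimensional ℂ (Ext X Y n)) ∧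
      (∀ n : ℕ, Module.finrank ℝ V < n → Subsingleton (Ext X Y n)) ∧
      twistedEulerPoincare hX hY = twistedEllipticPairing δ (resW X) DX (resW Y) DY ∧
      -- dependence on the restrictions to `W ⋊ ⟨δ⟩` only
      (∀ (X' Y' : ModuleCat.{u} (Hecke b k)) [FiniteDimensional ℂ X'] [FiniteDimensional ℂ Y']
        (DX' : Module.End ℂ X') (DY' : Module.End ℂ Y')
        (hX' : IsTwistAction hk hδ hin X' DX') (hY' : IsTwistAction hk hδ hin Y' DY'),
        IsoOverWTwist X X' DX DX' → IsoOverWTwist Y Y' DY DY' →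
          twistedEulerPoincare hX hY = twistedEulerPoincare hX' hY')) ∧
    -- the identity and the involution arising from the longest element are among these `δ`
    (∀ δ : P.Aut, δ = 1 ∨ IsOpposition b δ → InducesInner P δ) ∧
    -- the case `δ = Id`, in terms of dimensions
    (∀ (X Y : ModuleCat.{u} (Hecke b k)) [FiniteDimensional ℂ X] [FiniteDimensional ℂ Y],
      (∀ n : ℕ, FiniteDimensional ℂ (Ext X Y n)) ∧
      (∀ n : ℕ, Module.finrank ℝ V < n → Subsingleton (Ext X Y n)) ∧
      eulerPoincare X Y = ellipticPairing P (resW X) (resW Y) ∧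
      (∀ (X' Y' : ModuleCat.{u} (Hecke b k)) [FiniteDimensional ℂ X'] [FiniteDimensional ℂ Y'],
        IsoOverW X X' → IsoOverW Y Y' → eulerPoincare X Y = eulerPoincare X' Y')) := by
  refine ⟨?_, ?_, ?_⟩
  · intro δ hδ hin X Y _ _ DX DY hX hY
    obtain ⟨h1, h2, h3⟩ := twistedEulerPoincare_eq hX hY
    refine ⟨h1, h2, h3, ?_⟩
    intro X' Y' _ _ DX' DY' hX' hY' hXX' hYY'
    rw [h3, (twistedEulerPoincare_eq hX' hY').2.2, twistedEllipticPairing_congr δ hXX' hYY']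
  · rintro δ (rfl | h)
    · exact inducesInner_one
    · exact h.inducesInner
  · intro X Y _ _
    obtain ⟨h1, h2, h3⟩ := eulerPoincare_eq X Y hk
    refine ⟨h1, h2, h3, ?_⟩
    intro X' Y' _ _ hXX' hYY'
    rw [h3, (eulerPoincare_eq X' Y' hk).2.2, ellipticPairing_congr hXX' hYY']
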